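/- Let $n\ge 1$, let $\lambda=(\lambda_1\ge\lambda_2\ge\cdots)$ be a partition of $n$ (into positive parts), identified with its Ferrers diagram, and let $\lambda'$ be the conjugate partition. A standard Young tableau $T$ of shape $\lambda$ is a filling of the cells of $\lambda$ with $1,\dots,n$, each used exactly once, increasing along every row and down every column. Its descent set $D(T)$ is the set of all $i$ with $1\le i\le n-1$ such that $i+1$ lies strictly south (and weakly west) of $i$ in $T$. For $f\colon\mathbb N\to\mathbb R$ put $d_f(T)=\sum_{i\in D(T)}f(i)$, and let $E_\lambda(d_f)$ and $V_\lambda(d_f)$ be the expectation and the variance of $d_f$ over a uniformly random standard Young tableau of shape $\lambda$. For a partition $\mu$ of $n$ with conjugate $\mu'$ put $$c_\mu=\frac12\left[1+\sum_i\frac{\mu_i(\mu_i-1)}{n(n-1)}-\sum_i\frac{\mu_i'(\mu_i'-1)}{n(n-1)}\right],$$ $$d_\mu=\sum_{\substack{i\ge j\ge k\\ \mu_k>2}}\frac{\mu_i(\mu_j-1)(\mu_k-2)}{n(n-1)(n-2)},\qquad e_\mu=\sum_{\substack{i\ge j\ge k\ge l\\ \mu_l>3}}\frac{\mu_i(\mu_j-1)(\mu_k-2)(\mu_l-3)}{n(n-1)(n-2)(n-3)},$$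 where all indices run over the parts of the partition concerned (for $n=1$ the fractions in $c_\mu$ are read as $0$). **Theorem.** For every $f\colon\mathbb N\to\mathbb R$ and every partition $\lambda$ of $n$, $$E_\lambda(d_f)=c_{\lambda'}\sum_{i=1}^{n-1}f(i)$$ and $$V_\lambda(d_f)=c_{\lambda'}\sum_{i=1}^{n-1}f(i)^2+2d_{\lambda'}\sum_{i=1}^{n-2}f(i)f(i+1)+2\left(c_{\lambda'}-d_\lambda-d_{\lambda'}+e_\lambda+e_{\lambda'}\right)\sum_{\substack{1\le i,j\le n-1\\ i-j>1}}f(i)f(j)-\left(c_{\lambda'}\sum_{i=1}^{n-1}f(i)\right)^2.$$ Moreover, if $n\ge2$, then $$c_{\lambda'}=\sum_{i\ge j}\frac{\lambda_i'(\lambda_j'-1)}{n(n-1)},$$ and the number of standard Young tableaux of shape $\lambda$ is $$N=n!\prod_{(i,j)}\left(\lambda_i+\lambda_j'-i-j+1\right)^{-1},$$ the product being over all cells of $\lambda$, where $(i,j)$ is the cell in row $i$ and column $j$ (this last formula holds for all $n\ge1$). -/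

import Mathlib

open Finset

namespace DescentStat

/-! A partition `λ` of `n` is identified with its Young diagram, `μ : YoungDiagram` with `μ.card = n`.
Cells are pairs (row, column), indexed from `0` (English convention); the part `λ_{i+1}` is
`μ.rowLen i`, the part `λ'_{j+1}` of the conjugate partition is `μ.colLen j = μ.transpose.rowLen j`. -/

/-- Standard Young tableaux of shape `μ`: bijective fillings of the cells with `1, …, n`
that increase along every row and down every column. -/
abbrev StandardTableau (μ : YoungDiagram) : Type :=
  {T : {x // x ∈ μ.cells} ≃ {k // k ∈ Icc 1 μ.card} //
    (∀ a b : {x // x ∈ μ.cells}, a.1.1 = b.1.1 → a.1.2 < b.1.2 → (T a).1 < (T b).1) ∧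
    (∀ a b : {x // x ∈ μ.cells}, a.1.2 = b.1.2 → a.1.1 < b.1.1 → (T a).1 < (T b).1)}

/-- `T` has a descent at `i`: the entry `i + 1` is strictly south and weakly west of `i`. -/
abbrev HasDescentAt {μ : YoungDiagram} (T : StandardTableau μ) (i : ℕ) : Prop :=
  ∃ a b : {x // x ∈ μ.cells}, (T.1 a).1 = i ∧ (T.1 b).1 = i + 1 ∧
    a.1.1 < b.1.1 ∧ b.1.2 ≤ a.1.2

/-- The descent set `D(T)`. (An element of `D(T)` is an entry of `T`, hence at most `n`.) -/
def descentSet {μ : YoungDiagram} (T : StandardTableau μ) : Finset ℕ :=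
  (Icc 1 μ.card).filter (fun i => HasDescentAt T i)

/-- The descent function `d_f(T) = ∑_{i ∈ D(T)} f i`. -/
def descentFun (f : ℕ → ℝ) {μ : YoungDiagram} (T : StandardTableau μ) : ℝ :=
  ∑ i ∈ descentSet T, f i

/-- The expectation of `X` over a uniformly random standard Young tableau of shape `μ`. -/
noncomputable def expectation (μ : YoungDiagram) (X : StandardTableau μ → ℝ) : ℝ :=
  (∑ T : StandardTableau μ, X T) / (Fintype.card (StandardTableau μ) : ℝ)

/-- The variance of `X` over a uniformly random standard Young tableau of shape `μ`. -/
noncomputable def variance (μ : YoungDiagram) (X : StandardTableau μ → ℝ) : ℝ :=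
  expectation μ (fun T => (X T - expectation μ X) ^ 2)

/-- `c_μ = 1/2 [1 + ∑ μ_i (μ_i - 1) / (n (n-1)) - ∑ μ'_i (μ'_i - 1) / (n (n-1))]`. -/
noncomputable def coeffC (μ : YoungDiagram) : ℝ :=
  1 / 2 * (1
    + ∑ i ∈ range (μ.colLen 0),
        (μ.rowLen i : ℝ) * ((μ.rowLen i : ℝ) - 1) / ((μ.card : ℝ) * ((μ.card : ℝ) - 1))
    - ∑ j ∈ range (μ.rowLen 0),
        (μ.colLen j : ℝ) * ((μ.colLen j : ℝ) - 1) / ((μ.card : ℝ) * ((μ.card : ℝ) - 1)))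

/-- The sum `∑_{i ≥ j} μ_i (μ_j - 1) / (n (n-1))`. -/
noncomputable def coeffCSum (μ : YoungDiagram) : ℝ :=
  ∑ i ∈ range (μ.colLen 0), ∑ j ∈ range (i + 1),
    (μ.rowLen i : ℝ) * ((μ.rowLen j : ℝ) - 1) / ((μ.card : ℝ) * ((μ.card : ℝ) - 1))

/-- `d_μ = ∑_{i ≥ j ≥ k, μ_k > 2} μ_i (μ_j - 1) (μ_k - 2) / (n (n-1) (n-2))`. -/
noncomputable def coeffD (μ : YoungDiagram) : ℝ :=
  ∑ i ∈ range (μ.colLen 0), ∑ j ∈ range (i + 1),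
    ∑ k ∈ range (j + 1) with 2 < μ.rowLen k,
      (μ.rowLen i : ℝ) * ((μ.rowLen j : ℝ) - 1) * ((μ.rowLen k : ℝ) - 2) /
        ((μ.card : ℝ) * ((μ.card : ℝ) - 1) * ((μ.card : ℝ) - 2))

/-- `e_μ = ∑_{i ≥ j ≥ k ≥ l, μ_l > 3} μ_i (μ_j - 1) (μ_k - 2) (μ_l - 3) / (n (n-1) (n-2) (n-3))`. -/
noncomputable def coeffE (μ : YoungDiagram) : ℝ :=
  ∑ i ∈ range (μ.colLen 0), ∑ j ∈ range (i + 1), ∑ k ∈ range (j + 1),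
    ∑ l ∈ range (k + 1) with 3 < μ.rowLen l,
      (μ.rowLen i : ℝ) * ((μ.rowLen j : ℝ) - 1) * ((μ.rowLen k : ℝ) - 2) *
          ((μ.rowLen l : ℝ) - 3) /
        ((μ.card : ℝ) * ((μ.card : ℝ) - 1) * ((μ.card : ℝ) - 2) * ((μ.card : ℝ) - 3))

/-- `n! ∏ (hook length)⁻¹`, the product over the cells of `μ`. For the cell in row `i` and column
`j` (counted from `1`) the hook length is `μ_i + μ'_j - i - j + 1`. -/
noncomputable def hookNumber (μ : YoungDiagram) : ℝ :=
  (μ.card.factorial : ℝ) *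
    ∏ x ∈ μ.cells, ((μ.rowLen x.1 : ℝ) + (μ.colLen x.2 : ℝ)
      - ((x.1 : ℝ) + 1) - ((x.2 : ℝ) + 1) + 1)⁻¹

end DescentStat

namespace DescentStat

/-! ### Corners of a Young diagram and lattice words -/

/-! Listing the rows of the entries turns standard tableaux into lattice words, and `i` is a descent
exactly when `i + 1` lies in a lower row than `i` (`hasDescentAt_iff`). Both moments of the descent
function thus reduce to `ascentPairs`, the number of words with ascents at two given positions.

Elementary Knuth moves are involutions on the lattice words of a given content that exchange the
ascent status of two neighbouring positions. Hence `ascentPairs` depends only on whether the two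
positions are equal, adjacent or further apart (`ascentPairs_diag`, `ascentPairs_adjacent`,
`ascentPairs_far`) and can be evaluated on the smallest entries. There inclusion-exclusion
(`ascentPairs_far_eq`) leaves only the tableaux in which `1, …, k` lie in the first row, or in the
first column, with `k ≤ 4`.

With `F(μ)` the number of tableaux of shape `μ`, the count for the first row is `F(μ) h_k(μ) /
(n(n-1)⋯(n-k+1))`, where `h_k` is a shifted complete homogeneous function (`runCount_false`). The
quotients for `k = 2, 3, 4` are the coefficients `c`, `d`, `e`; columns follow by transposition. The
count is proved by removing the cell of the largest entry. This needs the sum over corners of `W_r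
h_k(μ - r)` to be `(n - k) h_k(μ)`, where `W_r = n F(μ - r) / F(μ)` has an explicit product form. To
see it (`sum_weight_shiftedHom`), expand in inverse falling factorials: the generating function of
the `h_k` is a product, removing a cell changes one factor, and the sum over corners becomes a
partial fraction expansion.

The case `k = 1` says that the `W_r` add up to `n`. Since hook products change by the factor `W_r`
when a corner is removed (`prod_hook_remove`), this is the recursion that proves the hook length
formula. -/

/-- The corners of a Young diagram: the cells whose removal leaves a Young diagram. -/
def corners (μ : YoungDiagram) : Finset (ℕ × ℕ) :=
  μ.cells.filter fun c => (c.1 + 1, c.2) ∉ μ ∧ (c.1, c.2 + 1) ∉ μ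

/-- Removing the cells weakly south-east of `c`; for a corner this removes `c` only. -/
def remove (μ : YoungDiagram) (c : ℕ × ℕ) : YoungDiagram where
  cells := μ.cells.filter fun x => ¬ c ≤ x
  isLowerSet := by
    intro a b hba ha
    simp only [coe_filter, Set.mem_ofPred_eq] at ha ⊢
    exact ⟨μ.isLowerSet hba ha.1, fun h => ha.2 (h.trans hba)⟩

theorem mem_remove {μ : YoungDiagram} {c x : ℕ × ℕ} : x ∈ remove μ c ↔ x ∈ μ ∧ ¬ c ≤ x := by
  rw [← YoungDiagram.mem_cells]
  simp only [remove, mem_filter, YoungDiagram.mem_cells]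

theorem mem_corners_iff {μ : YoungDiagram} {c : ℕ × ℕ} :
    c ∈ corners μ ↔ μ.rowLen c.1 = c.2 + 1 ∧ μ.rowLen (c.1 + 1) ≤ c.2 := by
  simp only [corners, mem_filter, YoungDiagram.mem_cells, YoungDiagram.mem_iff_lt_rowLen]
  obtain ⟨a, b⟩ := c
  simp only [YoungDiagram.mem_iff_lt_rowLen]
  omega

theorem mem_corners_iff_colLen {μ : YoungDiagram} {c : ℕ × ℕ} :
    c ∈ corners μ ↔ μ.colLen c.2 = c.1 + 1 ∧ μ.colLen (c.2 + 1) ≤ c.1 := by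
  simp only [corners, mem_filter, YoungDiagram.mem_cells, YoungDiagram.mem_iff_lt_colLen]
  obtain ⟨a, b⟩ := c
  simp only [YoungDiagram.mem_iff_lt_colLen]
  omega

theorem mem_of_mem_corners {μ : YoungDiagram} {c : ℕ × ℕ} (h : c ∈ corners μ) : c ∈ μ :=
  (mem_filter.1 h).1

theorem cells_remove {μ : YoungDiagram} {c : ℕ × ℕ} (h : c ∈ corners μ) :
    (remove μ c).cells = μ.cells.erase c := by
  ext ⟨a, b⟩
  obtain ⟨r, s⟩ := c
  rw [mem_corners_iff] at h
  simp only at h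
  rw [YoungDiagram.mem_cells, mem_remove, mem_erase, YoungDiagram.mem_cells,
    YoungDiagram.mem_iff_lt_rowLen, Prod.mk_le_mk, ne_eq, Prod.mk.injEq]
  constructor
  · rintro ⟨h1, h2⟩
    exact ⟨fun hh => h2 ⟨by omega, by omega⟩, h1⟩
  · rintro ⟨h1, h2⟩
    refine ⟨h2, fun ⟨h3, h4⟩ => h1 ?_⟩
    rcases h3.eq_or_lt with h3 | h3
    · subst h3; omega
    · have := μ.rowLen_anti (r + 1) a h3
      omega

theorem card_remove {μ : YoungDiagram} {c : ℕ × ℕ} (h : c ∈ corners μ) :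
    (remove μ c).card + 1 = μ.card := by
  unfold YoungDiagram.card
  rw [cells_remove h]
  exact card_erase_add_one (mem_of_mem_corners h)

theorem rowLen_remove {μ : YoungDiagram} {c : ℕ × ℕ} (h : c ∈ corners μ) (i : ℕ) :
    (remove μ c).rowLen i = if i = c.1 then μ.rowLen i - 1 else μ.rowLen i := by
  have key : ∀ j, j < (remove μ c).rowLen i ↔ j < μ.rowLen i ∧ ¬ (i = c.1 ∧ j = c.2) := by
    intro j
    rw [← YoungDiagram.mem_iff_lt_rowLen, ← YoungDiagram.mem_cells, cells_remove h, mem_erase,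
      YoungDiagram.mem_cells, YoungDiagram.mem_iff_lt_rowLen]
    rw [and_comm, ne_eq, Prod.ext_iff]
  rw [mem_corners_iff] at h
  split_ifs with hi
  · subst hi
    apply le_antisymm
    · by_contra hh
      push Not at hh
      have := (key _).1 hh
      omega
    · by_contra hh
      push Not at hh
      have := mt (key (remove μ c |>.rowLen c.1)).2 (lt_irrefl _)
      omega
  · apply le_antisymm
    · by_contra hh
      push Not at hh
      have := (key _).1 hh
      omega
    · by_contra hh
      push Not at hh
      have := mt (key (remove μ c |>.rowLen i)).2 (lt_irrefl _)
      simp [hi] at this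
      omega

theorem mem_corners_transpose {μ : YoungDiagram} {c : ℕ × ℕ} :
    c ∈ corners μ.transpose ↔ c.swap ∈ corners μ := by
  rw [mem_corners_iff, mem_corners_iff_colLen]
  simp

theorem remove_transpose (μ : YoungDiagram) (c : ℕ × ℕ) :
    remove μ.transpose c.swap = (remove μ c).transpose := by
  ext ⟨a, b⟩
  obtain ⟨r, s⟩ := c
  simp only [YoungDiagram.mem_cells, mem_remove, YoungDiagram.mem_transpose, Prod.swap_prod_mk,
    Prod.mk_le_mk, and_comm]

theorem sum_corners_transpose {M : Type*} [AddCommMonoid M] (μ : YoungDiagram)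
    (F : YoungDiagram → M) :
    ∑ c ∈ corners μ.transpose, F (remove μ.transpose c) =
      ∑ c ∈ corners μ, F (remove μ c).transpose := by
  refine (sum_nbij' Prod.swap Prod.swap ?_ ?_ ?_ ?_ ?_).symm
  · intro c hc; rw [mem_corners_transpose]; simpa using hc
  · intro c hc; rwa [mem_corners_transpose] at hc
  · intro c _; simp
  · intro c _; simp
  · intro c _; rw [remove_transpose]

theorem card_transpose (μ : YoungDiagram) : μ.transpose.card = μ.card := by
  simp [YoungDiagram.card, YoungDiagram.transpose]

theorem fst_injOn_corners (μ : YoungDiagram) : Set.InjOn Prod.fst (corners μ : Set (ℕ × ℕ)) := by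
  intro a ha b hb hab
  rw [mem_coe, mem_corners_iff] at ha hb
  rw [hab] at ha
  exact Prod.ext hab (by omega)

/-- A list of natural numbers, read from its end, is a lattice word. -/
def IsLattice : List ℕ → Prop
  | [] => True
  | a :: w => IsLattice w ∧ ∀ r, (a :: w).count (r + 1) ≤ (a :: w).count r

theorem IsLattice.count_le {w : List ℕ} (h : IsLattice w) (r : ℕ) :
    w.count (r + 1) ≤ w.count r := by
  cases w with
  | nil => simp
  | cons a w => exact h.2 r

/-- The lattice words of length `n` whose letter counts are the row lengths of `μ`. -/
def words : ℕ → YoungDiagram → Finset (List ℕ)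
  | 0, μ => if μ.cells = ∅ then {[]} else ∅
  | n + 1, μ => (corners μ).biUnion fun c => (words n (remove μ c)).image (List.cons c.1)

/-- The head of the list is the letter read last. Deleting it deletes the end cell of a row, and the
lattice condition says precisely that the content before and after is a partition, so that this cell
is a corner. -/
theorem mem_words {n : ℕ} {μ : YoungDiagram} {w : List ℕ} :
    w ∈ words n μ ↔ w.length = n ∧ IsLattice w ∧ ∀ r, w.count r = μ.rowLen r := by
  induction n generalizing μ w with
  | zero =>
    simp only [words]
    constructor
    · intro h
      split_ifs at h with hμ
      · rw [mem_singleton] at h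
        subst h
        refine ⟨rfl, trivial, fun r => ?_⟩
        by_contra hr
        have : (r, 0) ∈ μ := YoungDiagram.mem_iff_lt_rowLen.2 (by simp at hr; omega)
        rw [← YoungDiagram.mem_cells, hμ] at this
        simp at this
      · simp at h
    · rintro ⟨h1, -, h3⟩
      rw [List.length_eq_zero_iff] at h1
      subst h1
      rw [if_pos]
      · simp
      · ext ⟨a, b⟩
        simp [YoungDiagram.mem_iff_lt_rowLen, ← h3]
  | succ n ih =>
    simp only [words, mem_biUnion, mem_image, ih]
    constructor
    · rintro ⟨c, hc, v, ⟨h1, h2, h3⟩, rfl⟩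
      have hcount : ∀ r, (c.1 :: v).count r = μ.rowLen r := by
        intro r
        rw [List.count_cons, h3, rowLen_remove hc]
        have := (mem_corners_iff.1 hc).1
        by_cases hr : r = c.1
        · subst hr; simp; omega
        · simp [hr, Ne.symm hr]
      refine ⟨by simp [h1], ⟨h2, fun r => ?_⟩, hcount⟩
      rw [hcount, hcount]
      exact μ.rowLen_anti _ _ (Nat.le_succ r)
    · rintro ⟨h1, h2, h3⟩
      cases w with
      | nil => simp at h1
      | cons a v =>
        have ha := h3 a
        simp only [List.count_cons_self] at ha
        have ha1 := h3 (a + 1)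
        rw [List.count_cons_of_ne (by omega)] at ha1
        -- The last letter `a` occupies the cell of row `a` after those of the earlier letters `a`,
        -- which gives its column.
        have hc : (a, v.count a) ∈ corners μ := by
          rw [mem_corners_iff]
          refine ⟨ha.symm, ?_⟩
          rw [← ha1]
          exact h2.1.count_le a
        refine ⟨_, hc, v, ⟨by simpa using h1, h2.1, fun r => ?_⟩, rfl⟩
        rw [rowLen_remove hc, ← h3 r, List.count_cons]
        by_cases hr : r = a
        · subst hr; simp
        · simp [hr, Ne.symm hr]

theorem sum_words_succ {M : Type*} [AddCommMonoid M] (n : ℕ) (μ : YoungDiagram)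
    (F : List ℕ → M) :
    ∑ w ∈ words (n + 1) μ, F w =
      ∑ c ∈ corners μ, ∑ w ∈ words n (remove μ c), F (c.1 :: w) := by
  rw [words, sum_biUnion]
  · refine sum_congr rfl fun c _ => ?_
    rw [sum_image]
    intro a _ b _ h
    simpa using h
  · intro c hc d hd hcd
    rw [Function.onFun, disjoint_left]
    intro w h1 h2
    simp only [mem_image] at h1 h2
    obtain ⟨v, -, rfl⟩ := h1
    obtain ⟨u, -, h⟩ := h2
    exact hcd (fst_injOn_corners μ hc hd (by simpa using (List.cons.inj h).1.symm))

/-- The number of lattice words of content `μ`. -/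
def numWords (n : ℕ) (μ : YoungDiagram) : ℕ := (words n μ).card

theorem numWords_succ (n : ℕ) (μ : YoungDiagram) :
    numWords (n + 1) μ = ∑ c ∈ corners μ, numWords n (remove μ c) := by
  have := sum_words_succ n μ (fun _ => 1)
  simpa [numWords] using this

/-- The corner recursion is symmetric under transposition, so no bijection between words is needed.
-/
theorem numWords_transpose (n : ℕ) (μ : YoungDiagram) :
    numWords n μ.transpose = numWords n μ := by
  induction n generalizing μ with
  | zero =>
    simp only [numWords, words]
    have : μ.transpose.cells = ∅ ↔ μ.cells = ∅ := by
      rw [← card_eq_zero, ← card_eq_zero]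
      exact Eq.congr (card_transpose μ) rfl
    simp only [this]
  | succ n ih =>
    rw [numWords_succ, numWords_succ, sum_corners_transpose μ (fun ν => numWords n ν)]
    exact sum_congr rfl fun c _ => ih _

/-! ### Knuth moves on lattice words -/

/-- Whether the `j`-th letter from the front of the list is larger than the next one. -/
def ascent : ℕ → List ℕ → Bool
  | 0, b :: a :: _ => decide (a < b)
  | j + 1, _ :: w => ascent j w
  | _, _ => false

/-- The elementary Knuth move at the front of the list `c :: b :: a :: w`. -/
def knuthHead (c b a : ℕ) (w : List ℕ) : List ℕ :=
  if (c ≤ a ∧ a < b) ∨ (b ≤ a ∧ a < c) then b :: c :: a :: w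
  else if (b < c ∧ c ≤ a) ∨ (a < c ∧ c ≤ b) then c :: a :: b :: w
  else c :: b :: a :: w

/-- The elementary Knuth move on the letters `j`, `j + 1`, `j + 2`. -/
def knuth : ℕ → List ℕ → List ℕ
  | 0, c :: b :: a :: w => knuthHead c b a w
  | j + 1, x :: w => x :: knuth j w
  | _, w => w

theorem knuthHead_perm (c b a : ℕ) (w : List ℕ) :
    (knuthHead c b a w).Perm (c :: b :: a :: w) := by
  unfold knuthHead
  split_ifs
  · exact List.Perm.swap _ _ _
  · exact (List.Perm.swap _ _ _).cons _
  · exact List.Perm.refl _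

theorem knuth_perm (j : ℕ) (w : List ℕ) : (knuth j w).Perm w := by
  induction j generalizing w with
  | zero =>
    match w with
    | [] | [_] | [_, _] => exact List.Perm.refl _
    | c :: b :: a :: w => exact knuthHead_perm c b a w
  | succ j ih =>
    match w with
    | [] => exact List.Perm.refl _
    | x :: w => exact (ih w).cons x

theorem knuth_knuth (j : ℕ) (w : List ℕ) : knuth j (knuth j w) = w := by
  induction j generalizing w with
  | zero =>
    match w with
    | [] | [_] | [_, _] => rfl
    | c :: b :: a :: w =>
      simp only [knuth, knuthHead]
      split_ifs <;> simp only [knuth, knuthHead] <;> split_ifs <;> first | rfl | omega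
  | succ j ih =>
    match w with
    | [] => rfl
    | x :: w => simp only [knuth, ih]

/-- A swap changes one intermediate content, and only swapped letters `r`, `r + 1` could do harm
there. The third letter of the triple then equals `r` if it is read before them and `r + 1` if it is
read after them; either way the inequality survives. -/
theorem isLattice_knuth (j : ℕ) (w : List ℕ) (h : IsLattice w) : IsLattice (knuth j w) := by
  induction j generalizing w with
  | zero =>
    match w with
    | [] | [_] | [_, _] => exact h
    | c :: b :: a :: w =>
      obtain ⟨⟨⟨h0, h1⟩, h2⟩, h3⟩ := h
      simp only [knuth, knuthHead]
      split_ifs with hc hc'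
      · refine ⟨⟨⟨h0, h1⟩, fun r => ?_⟩, fun r => ?_⟩ <;>
        · have e0 := h0.count_le r
          have e1 := h1 r
          have e3 := h3 r
          simp only [List.count_cons, beq_iff_eq] at e1 e3 ⊢
          split_ifs at e1 e3 ⊢ <;> omega
      · refine ⟨⟨⟨h0, fun r => ?_⟩, fun r => ?_⟩, fun r => ?_⟩ <;>
        · have e0 := h0.count_le r
          have e2 := h2 r
          have e3 := h3 r
          simp only [List.count_cons, beq_iff_eq] at e2 e3 ⊢
          split_ifs at e2 e3 ⊢ <;> omega
      · exact ⟨⟨⟨h0, h1⟩, h2⟩, h3⟩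
  | succ j ih =>
    match w with
    | [] => exact h
    | x :: w =>
      refine ⟨ih w h.1, fun r => ?_⟩
      have := h.2 r
      rwa [((knuth_perm j w).cons x).count_eq, ((knuth_perm j w).cons x).count_eq]

theorem knuth_mem_words {n : ℕ} {μ : YoungDiagram} (j : ℕ) {w : List ℕ} (h : w ∈ words n μ) :
    knuth j w ∈ words n μ := by
  rw [mem_words] at h ⊢
  refine ⟨(knuth_perm j w).length_eq.trans h.1, isLattice_knuth j w h.2.1, fun r => ?_⟩
  rw [(knuth_perm j w).count_eq, h.2.2]

/-- The two cases of the move cover exactly the triples with one ascent and one non-ascent; a triple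
with two equal statuses is fixed. -/
theorem ascent_knuth_swap (j : ℕ) (w : List ℕ) (hw : j + 3 ≤ w.length) :
    ascent j (knuth j w) = ascent (j + 1) w ∧ ascent (j + 1) (knuth j w) = ascent j w := by
  induction j generalizing w with
  | zero =>
    match w, hw with
    | c :: b :: a :: w, _ =>
      simp only [knuth, knuthHead]
      split_ifs <;> simp only [ascent, decide_eq_decide] <;> omega
  | succ j ih =>
    match w, hw with
    | x :: w, hw => simpa only [knuth, ascent] using ih w (by simpa using hw)

theorem ascent_knuth_of_lt (i j : ℕ) (w : List ℕ) (hij : j + 2 < i) :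
    ascent i (knuth j w) = ascent i w := by
  induction j generalizing w i with
  | zero =>
    obtain ⟨i, rfl⟩ := Nat.exists_eq_add_of_le' hij
    match w with
    | [] | [_] | [_, _] => rfl
    | c :: b :: a :: w =>
      simp only [knuth, knuthHead]
      split_ifs <;> simp only [ascent]
  | succ j ih =>
    obtain ⟨i, rfl⟩ := Nat.exists_eq_add_of_le' (Nat.zero_lt_of_lt hij)
    match w with
    | [] => rfl
    | x :: w => simpa only [knuth, ascent] using ih i w (by omega)

theorem ascent_knuth_of_gt (i j : ℕ) (w : List ℕ) (hij : i + 1 < j) :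
    ascent i (knuth j w) = ascent i w := by
  induction i generalizing w j with
  | zero =>
    obtain ⟨j, rfl⟩ := Nat.exists_eq_add_of_le' hij
    match w with
    | [] | [_] | _ :: _ :: _ => rfl
  | succ i ih =>
    obtain ⟨j, rfl⟩ := Nat.exists_eq_add_of_le' (Nat.zero_lt_of_lt hij)
    match w with
    | [] => rfl
    | x :: w => simpa only [knuth, ascent] using ih j w (by omega)

/-- Shifting a pair of adjacent ascents takes two moves, each of which may disturb a neighbouring
position. That the pair survives is a finite comparison of four letters. `ascent_pair_pred` treats
the inverse composition, so together they give equality of the counts. -/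
theorem ascent_pair_succ (j : ℕ) (w : List ℕ) (hw : j + 4 ≤ w.length)
    (h0 : ascent j w = true) (h1 : ascent (j + 1) w = true) :
    ascent (j + 1) (knuth j (knuth (j + 1) w)) = true ∧
      ascent (j + 2) (knuth j (knuth (j + 1) w)) = true := by
  induction j generalizing w with
  | zero =>
    match w, hw with
    | d :: c :: b :: a :: w, _ =>
      simp only [ascent, decide_eq_true_eq] at h0 h1
      simp only [knuth, knuthHead]
      split_ifs <;> simp only [knuth, knuthHead] <;> split_ifs <;>
        simp only [ascent, decide_eq_true_eq] <;> omega
  | succ j ih =>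
    match w, hw with
    | x :: w, hw =>
      simpa only [knuth, ascent] using ih w (by simpa using hw) (by simpa only [ascent] using h0)
        (by simpa only [ascent] using h1)

theorem ascent_pair_pred (j : ℕ) (w : List ℕ) (hw : j + 4 ≤ w.length)
    (h0 : ascent (j + 1) w = true) (h1 : ascent (j + 2) w = true) :
    ascent j (knuth (j + 1) (knuth j w)) = true ∧
      ascent (j + 1) (knuth (j + 1) (knuth j w)) = true := by
  induction j generalizing w with
  | zero =>
    match w, hw with
    | d :: c :: b :: a :: w, _ =>
      simp only [ascent, decide_eq_true_eq] at h0 h1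
      simp only [knuth, knuthHead]
      split_ifs <;> simp only [knuth, knuthHead] <;> split_ifs <;>
        simp only [ascent, decide_eq_true_eq] <;> omega
  | succ j ih =>
    match w, hw with
    | x :: w, hw =>
      simpa only [knuth, ascent] using ih w (by simpa using hw) (by simpa only [ascent] using h0)
        (by simpa only [ascent] using h1)

/-! ### Joint ascent counts and their invariance -/

/-- The number of lattice words of content `μ` with ascents at both positions `i` and `j`. -/
def ascentPairs (n : ℕ) (μ : YoungDiagram) (i j : ℕ) : ℕ :=
  ((words n μ).filter fun w => ascent i w = true ∧ ascent j w = true).card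

theorem ascentPairs_comm (n : ℕ) (μ : YoungDiagram) (i j : ℕ) :
    ascentPairs n μ i j = ascentPairs n μ j i := by
  simp only [ascentPairs, and_comm]

theorem card_filter_words_le {n : ℕ} {μ : YoungDiagram} {p q : List ℕ → Prop} [DecidablePred p]
    [DecidablePred q] (φ ψ : List ℕ → List ℕ) (hφ : ∀ w ∈ words n μ, φ w ∈ words n μ)
    (hψ : ∀ w, ψ (φ w) = w) (hpq : ∀ w ∈ words n μ, p w → q (φ w)) :
    ((words n μ).filter p).card ≤ ((words n μ).filter q).card := by
  refine card_le_card_of_injOn φ ?_ (Function.LeftInverse.injective hψ).injOn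
  intro w hw
  rw [mem_coe, mem_filter] at hw ⊢
  exact ⟨hφ w hw.1, hpq w hw.1 hw.2⟩

theorem ascentPairs_diag_succ {n : ℕ} (μ : YoungDiagram) {j : ℕ} (hj : j + 3 ≤ n) :
    ascentPairs n μ j j = ascentPairs n μ (j + 1) (j + 1) := by
  apply le_antisymm <;>
  · refine card_filter_words_le (knuth j) (knuth j) (fun w hw => knuth_mem_words j hw)
      (knuth_knuth j) fun w hw h => ?_
    obtain ⟨h1, h2⟩ := ascent_knuth_swap j w (hj.trans_eq (mem_words.1 hw).1.symm)
    simpa only [h1, h2] using h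

theorem ascentPairs_adjacent_succ {n : ℕ} (μ : YoungDiagram) {j : ℕ} (hj : j + 4 ≤ n) :
    ascentPairs n μ j (j + 1) = ascentPairs n μ (j + 1) (j + 2) := by
  apply le_antisymm
  · refine card_filter_words_le (fun w => knuth j (knuth (j + 1) w))
      (fun w => knuth (j + 1) (knuth j w))
      (fun w hw => knuth_mem_words _ (knuth_mem_words _ hw)) ?_ fun w hw h => ?_
    · intro w; simp only [knuth_knuth]
    · exact ascent_pair_succ j w (hj.trans_eq (mem_words.1 hw).1.symm) h.1 h.2
  · refine card_filter_words_le (fun w => knuth (j + 1) (knuth j w))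
      (fun w => knuth j (knuth (j + 1) w))
      (fun w hw => knuth_mem_words _ (knuth_mem_words _ hw)) ?_ fun w hw h => ?_
    · intro w; simp only [knuth_knuth]
    · exact ascent_pair_pred j w (hj.trans_eq (mem_words.1 hw).1.symm) h.1 h.2

/-- The move at `j` touches only the letters `j`, `j + 1`, `j + 2`, and the ascent at `i` involves
the letters `i`, `i + 1`; under `hij` these do not meet. -/
theorem ascentPairs_succ_right {n : ℕ} (μ : YoungDiagram) {i j : ℕ} (hj : j + 3 ≤ n)
    (hij : j + 2 < i ∨ i + 1 < j) :
    ascentPairs n μ i j = ascentPairs n μ i (j + 1) := by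
  have hi : ∀ w, ascent i (knuth j w) = ascent i w := by
    intro w
    rcases hij with h | h
    · exact ascent_knuth_of_lt i j w h
    · exact ascent_knuth_of_gt i j w h
  apply le_antisymm <;>
  · refine card_filter_words_le (knuth j) (knuth j) (fun w hw => knuth_mem_words j hw)
      (knuth_knuth j) fun w hw h => ?_
    obtain ⟨h1, h2⟩ := ascent_knuth_swap j w (hj.trans_eq (mem_words.1 hw).1.symm)
    simpa only [h1, h2, hi] using h

theorem ascentPairs_diag {N : ℕ} (μ : YoungDiagram) {i : ℕ} (hi : i ≤ N) :
    ascentPairs (N + 2) μ i i = ascentPairs (N + 2) μ N N := by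
  obtain ⟨k, rfl⟩ := Nat.exists_eq_add_of_le hi
  clear hi
  induction k generalizing i with
  | zero => rfl
  | succ k ih =>
    rw [ascentPairs_diag_succ μ (by omega), show i + (k + 1) = i + 1 + k by omega, ih]

theorem ascentPairs_adjacent {N : ℕ} (μ : YoungDiagram) {i : ℕ} (hi : i ≤ N) :
    ascentPairs (N + 3) μ i (i + 1) = ascentPairs (N + 3) μ N (N + 1) := by
  obtain ⟨k, rfl⟩ := Nat.exists_eq_add_of_le hi
  clear hi
  induction k generalizing i with
  | zero => rfl
  | succ k ih =>
    rw [ascentPairs_adjacent_succ μ (by omega), show i + (k + 1) = i + 1 + k by omega, ih]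

/-- The larger index is slid to the end before the smaller one, so the gap never drops below two and
every slide is allowed. -/
theorem ascentPairs_far {N : ℕ} (μ : YoungDiagram) {i j : ℕ} (hij : i + 2 ≤ j) (hj : j ≤ N + 2) :
    ascentPairs (N + 4) μ i j = ascentPairs (N + 4) μ N (N + 2) := by
  have h1 : ascentPairs (N + 4) μ i j = ascentPairs (N + 4) μ i (N + 2) := by
    obtain ⟨k, hk⟩ := Nat.exists_eq_add_of_le hj
    rw [hk]
    have : ∀ l ≤ k, ascentPairs (N + 4) μ i j = ascentPairs (N + 4) μ i (j + l) := by
      intro l hl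
      induction l with
      | zero => rfl
      | succ l ih =>
        rw [ih (by omega), ascentPairs_succ_right μ (by omega) (Or.inr (by omega)), add_assoc]
    exact this k le_rfl
  rw [h1]
  obtain ⟨k, hk⟩ := Nat.exists_eq_add_of_le (show i ≤ N by omega)
  have : ∀ l ≤ k, ascentPairs (N + 4) μ i (N + 2) = ascentPairs (N + 4) μ (i + l) (N + 2) := by
    intro l hl
    induction l with
    | zero => rfl
    | succ l ih =>
      rw [ih (by omega), ascentPairs_comm, ascentPairs_succ_right μ (by omega) (Or.inl (by omega)),
        ascentPairs_comm, add_assoc]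
  rw [this k le_rfl, ← hk]

/-! ### Words that begin with a monotone run -/

/-- The number of lattice words of content `μ` and length `N + k` whose first `k` letters, read
from the end of the list, show only ascents (`b = true`) or only non-ascents (`b = false`). -/
def runCount (b : Bool) (k N : ℕ) (μ : YoungDiagram) : ℕ :=
  ((words (N + k) μ).filter fun w => ∀ i < k - 1, ascent (N + i) w = b).card

theorem runCount_succ (b : Bool) (k N : ℕ) (μ : YoungDiagram) :
    runCount b k (N + 1) μ = ∑ c ∈ corners μ, runCount b k N (remove μ c) := by
  simp only [runCount, card_filter]
  rw [show N + 1 + k = N + k + 1 by omega, sum_words_succ]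
  refine sum_congr rfl fun c _ => sum_congr rfl fun w _ => ?_
  simp only [show ∀ i, N + 1 + i = N + i + 1 by intro i; omega, ascent]

theorem runCount_two (N : ℕ) (μ : YoungDiagram) :
    runCount true 2 N μ = ascentPairs (N + 2) μ N N := by
  simp only [runCount, ascentPairs]
  congr 1
  refine filter_congr fun w _ => ⟨fun h => ⟨h 0 (by omega), h 0 (by omega)⟩, fun h i hi => ?_⟩
  obtain rfl : i = 0 := by omega
  exact h.1

theorem runCount_three (N : ℕ) (μ : YoungDiagram) :
    runCount true 3 N μ = ascentPairs (N + 3) μ N (N + 1) := by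
  simp only [runCount, ascentPairs]
  congr 1
  refine filter_congr fun w _ => ⟨fun h => ⟨h 0 (by omega), h 1 (by omega)⟩, fun h i hi => ?_⟩
  obtain rfl | rfl : i = 0 ∨ i = 1 := by omega
  · exact h.1
  · exact h.2

/-- Let `x`, `y`, `z` be the indicators of ascents at `N`, `N + 1`, `N + 2`. Once the single ascent
and the adjacent pair are slid to `N`, the identity holds word by word: `xz + (1-y)(1-z) + xy = x +
(1-x)(1-y)(1-z) + xyz`. -/
theorem ascentPairs_far_eq (N : ℕ) (μ : YoungDiagram) :
    ascentPairs (N + 4) μ N (N + 2) + runCount false 3 (N + 1) μ + runCount true 3 (N + 1) μ =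
      runCount true 2 (N + 2) μ + runCount false 4 N μ + runCount true 4 N μ := by
  rw [runCount_three, runCount_two, ← ascentPairs_diag μ (show N ≤ N + 2 by omega),
    ← ascentPairs_adjacent μ (show N ≤ N + 1 by omega)]
  have h3 : ∀ p : ℕ → Prop, (∀ i < 3 - 1, p i) ↔ p 0 ∧ p 1 := fun p =>
    ⟨fun h => ⟨h 0 (by omega), h 1 (by omega)⟩, fun h i hi => by
      obtain rfl | rfl : i = 0 ∨ i = 1 := by omega
      · exact h.1
      · exact h.2⟩
  have h4 : ∀ p : ℕ → Prop, (∀ i < 4 - 1, p i) ↔ p 0 ∧ p 1 ∧ p 2 := fun p =>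
    ⟨fun h => ⟨h 0 (by omega), h 1 (by omega), h 2 (by omega)⟩, fun h i hi => by
      obtain rfl | rfl | rfl : i = 0 ∨ i = 1 ∨ i = 2 := by omega
      · exact h.1
      · exact h.2.1
      · exact h.2.2⟩
  simp only [runCount, ascentPairs, card_filter, ← sum_add_distrib, h3, h4, add_zero, add_assoc,
    Nat.reduceAdd]
  refine sum_congr rfl fun w _ => ?_
  cases ascent N w <;> cases ascent (N + 1) w <;> cases ascent (N + 2) w <;> simp

theorem eq_replicate_of_no_ascent {w : List ℕ} (hw : IsLattice w)
    (h : ∀ i, i + 1 < w.length → ascent i w = false) : w = List.replicate w.length 0 := by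
  induction w with
  | nil => rfl
  | cons x w ih =>
    have hw' := ih hw.1 fun i hi => by simpa only [ascent] using h (i + 1) (by simpa using hi)
    rw [List.length_cons, List.replicate_succ, ← hw']
    congr 1
    by_contra hx
    obtain ⟨r, rfl⟩ := Nat.exists_eq_succ_of_ne_zero hx
    cases w with
    | nil => simpa using hw.2 r
    | cons y w =>
      have h0 := h 0 (by simp)
      rw [List.length_cons, List.replicate_succ, List.cons.injEq] at hw'
      simp [ascent, hw'.1] at h0

theorem eq_range_reverse_of_ascent {w : List ℕ} (hw : IsLattice w)
    (h : ∀ i, i + 1 < w.length → ascent i w = true) : w = (List.range w.length).reverse := by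
  induction w with
  | nil => rfl
  | cons x w ih =>
    have hw' := ih hw.1 fun i hi => by simpa only [ascent] using h (i + 1) (by simpa using hi)
    rw [List.length_cons, List.range_succ, List.reverse_append, ← hw']
    rw [List.reverse_singleton, List.singleton_append]
    congr 1
    apply le_antisymm
    · by_contra hx
      obtain ⟨r, rfl⟩ := Nat.exists_eq_succ_of_ne_zero (show x ≠ 0 by omega)
      have h1 := hw.2 r
      rw [List.count_cons_self, List.count_cons_of_ne (by omega),
        List.count_eq_zero_of_not_mem (l := w) (a := r)] at h1
      · omega
      · rw [hw', List.mem_reverse, List.mem_range]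
        omega
    · cases w with
      | nil => simp
      | cons y w =>
        have h0 := h 0 (by simp)
        rw [List.length_cons, List.range_succ, List.reverse_append, List.reverse_singleton,
          List.singleton_append, List.cons.injEq] at hw'
        simp only [ascent, decide_eq_true_eq] at h0
        simp only [List.length_cons]
        omega

/-! ### Standard tableaux as lattice words -/

/-- The list `[g k, …, g 1]`. -/
def wordOf (g : ℕ → ℕ) : ℕ → List ℕ
  | 0 => []
  | k + 1 => g (k + 1) :: wordOf g k

theorem length_wordOf (g : ℕ → ℕ) (k : ℕ) : (wordOf g k).length = k := by
  induction k with
  | zero => rfl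
  | succ k ih => simp [wordOf, ih]

theorem count_wordOf (g : ℕ → ℕ) (k r : ℕ) :
    (wordOf g k).count r = ((Icc 1 k).filter fun i => g i = r).card := by
  induction k with
  | zero => rfl
  | succ k ih =>
    rw [wordOf, List.count_cons, ih, ← insert_Icc_right_eq_Icc_add_one (by omega), filter_insert]
    by_cases h : g (k + 1) = r
    · rw [if_pos h, card_insert_of_notMem (by simp)]
      simp [h]
    · rw [if_neg h]
      simp [h]

theorem isLattice_wordOf (g : ℕ → ℕ) (n : ℕ) :
    IsLattice (wordOf g n) ↔
      ∀ k ≤ n, ∀ r, (wordOf g k).count (r + 1) ≤ (wordOf g k).count r := by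
  induction n with
  | zero => simp [wordOf, IsLattice]
  | succ n ih =>
    rw [wordOf, IsLattice, ih]
    constructor
    · rintro ⟨h1, h2⟩ k hk
      rcases hk.eq_or_lt with rfl | hk
      · exact h2
      · exact h1 k (by omega)
    · intro h
      exact ⟨fun k hk => h k (by omega), h _ le_rfl⟩

theorem wordOf_congr {g g' : ℕ → ℕ} {n : ℕ} :
    wordOf g n = wordOf g' n ↔ ∀ i ∈ Icc 1 n, g i = g' i := by
  induction n with
  | zero => simp [wordOf]
  | succ n ih =>
    rw [wordOf, wordOf, List.cons.injEq, ih, ← insert_Icc_right_eq_Icc_add_one (by omega),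
      forall_mem_insert]

theorem exists_wordOf (w : List ℕ) : ∃ g, wordOf g w.length = w := by
  induction w with
  | nil => exact ⟨fun _ => 0, rfl⟩
  | cons a w ih =>
    obtain ⟨g, hg⟩ := ih
    refine ⟨Function.update g (w.length + 1) a, ?_⟩
    rw [List.length_cons, wordOf, Function.update_self]
    congr 1
    conv_rhs => rw [← hg]
    rw [wordOf_congr]
    intro i hi
    rw [mem_Icc] at hi
    rw [Function.update_of_ne (by omega)]

theorem ascent_wordOf (g : ℕ → ℕ) (m j : ℕ) :
    ascent j (wordOf g (m + 2 + j)) = decide (g (m + 1) < g (m + 2)) := by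
  induction j with
  | zero => rfl
  | succ j ih => rw [← add_assoc, wordOf, ascent, ih]

section Tableaux

variable {μ : YoungDiagram}

/-- The cell of `T` with entry `i`. -/
def cellAt (T : StandardTableau μ) (i : ℕ) : ℕ × ℕ :=
  if h : i ∈ Icc 1 μ.card then (T.1.symm ⟨i, h⟩).1 else (0, 0)

/-- The entry of `T` in the cell `x`. -/
def entry (T : StandardTableau μ) (x : ℕ × ℕ) : ℕ :=
  if h : x ∈ μ.cells then (T.1 ⟨x, h⟩).1 else 0

theorem entry_mem (T : StandardTableau μ) {x : ℕ × ℕ} (h : x ∈ μ) :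
    entry T x ∈ Icc 1 μ.card := by
  have h' : x ∈ μ.cells := h
  rw [entry, dif_pos h']
  exact (T.1 ⟨x, h'⟩).2

theorem cellAt_mem (T : StandardTableau μ) {i : ℕ} (h : i ∈ Icc 1 μ.card) : cellAt T i ∈ μ := by
  rw [cellAt, dif_pos h]
  exact (T.1.symm ⟨i, h⟩).2

theorem entry_cellAt (T : StandardTableau μ) {i : ℕ} (h : i ∈ Icc 1 μ.card) :
    entry T (cellAt T i) = i := by
  have h1 : cellAt T i ∈ μ.cells := cellAt_mem T h
  rw [entry, dif_pos h1]
  have : (⟨cellAt T i, h1⟩ : {x // x ∈ μ.cells}) = T.1.symm ⟨i, h⟩ := by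
    apply Subtype.ext
    simp only [cellAt, dif_pos h]
  rw [this, Equiv.apply_symm_apply]

theorem cellAt_entry (T : StandardTableau μ) {x : ℕ × ℕ} (h : x ∈ μ) :
    cellAt T (entry T x) = x := by
  have h' : x ∈ μ.cells := h
  rw [cellAt, dif_pos (entry_mem T h)]
  have : (⟨entry T x, entry_mem T h⟩ : {k // k ∈ Icc 1 μ.card}) = T.1 ⟨x, h'⟩ := by
    apply Subtype.ext
    simp only [entry, dif_pos h']
  rw [this, Equiv.symm_apply_apply]

theorem entry_lt_of_row (T : StandardTableau μ) {r c c' : ℕ} (hc : c < c') (h : (r, c') ∈ μ) :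
    entry T (r, c) < entry T (r, c') := by
  have h1 : (r, c') ∈ μ.cells := h
  have h2 : (r, c) ∈ μ.cells := μ.up_left_mem le_rfl hc.le h
  rw [entry, entry, dif_pos h1, dif_pos h2]
  exact T.2.1 ⟨_, h2⟩ ⟨_, h1⟩ rfl hc

theorem entry_lt_of_col (T : StandardTableau μ) {r r' c : ℕ} (hr : r < r') (h : (r', c) ∈ μ) :
    entry T (r, c) < entry T (r', c) := by
  have h1 : (r', c) ∈ μ.cells := h
  have h2 : (r, c) ∈ μ.cells := μ.up_left_mem hr.le le_rfl h
  rw [entry, entry, dif_pos h1, dif_pos h2]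
  exact T.2.2 ⟨_, h2⟩ ⟨_, h1⟩ rfl hr

theorem card_filter_row (T : StandardTableau μ) {k : ℕ} (hk : k ≤ μ.card) (r : ℕ) :
    ((Icc 1 k).filter fun i => (cellAt T i).1 = r).card =
      ((range (μ.rowLen r)).filter fun c => entry T (r, c) ≤ k).card := by
  refine card_nbij' (fun i => (cellAt T i).2) (fun c => entry T (r, c)) ?_ ?_ ?_ ?_
  · intro i hi
    simp only [coe_filter, mem_Icc, Set.mem_ofPred_eq] at hi
    have hi' : i ∈ Icc 1 μ.card := mem_Icc.2 ⟨hi.1.1, hi.1.2.trans hk⟩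
    have hx : (r, (cellAt T i).2) = cellAt T i := by rw [← hi.2]
    simp only [coe_filter, mem_range, Set.mem_ofPred_eq]
    rw [← YoungDiagram.mem_iff_lt_rowLen, hx, entry_cellAt T hi']
    exact ⟨cellAt_mem T hi', hi.1.2⟩
  · intro c hc
    simp only [coe_filter, mem_range, Set.mem_ofPred_eq,
      ← YoungDiagram.mem_iff_lt_rowLen] at hc
    simp only [coe_filter, mem_Icc, Set.mem_ofPred_eq, cellAt_entry T hc.1, and_true]
    exact ⟨(mem_Icc.1 (entry_mem T hc.1)).1, hc.2⟩
  · intro i hi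
    simp only [coe_filter, mem_Icc, Set.mem_ofPred_eq] at hi
    have hi' : i ∈ Icc 1 μ.card := mem_Icc.2 ⟨hi.1.1, hi.1.2.trans hk⟩
    have hx : (r, (cellAt T i).2) = cellAt T i := by rw [← hi.2]
    simp only [hx, entry_cellAt T hi']
  · intro c hc
    simp only [coe_filter, mem_range, Set.mem_ofPred_eq,
      ← YoungDiagram.mem_iff_lt_rowLen] at hc
    simp only [cellAt_entry T hc.1]

/-- This recovers the column of a cell from the sequence of rows, which makes `tableauWord`
injective. -/
theorem card_filter_row_entry (T : StandardTableau μ) {x : ℕ × ℕ} (hx : x ∈ μ) :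
    ((Icc 1 (entry T x)).filter fun i => (cellAt T i).1 = x.1).card = x.2 + 1 := by
  rw [card_filter_row T (mem_Icc.1 (entry_mem T hx)).2]
  conv_rhs => rw [← card_range (x.2 + 1)]
  congr 1
  ext c
  have hx' := YoungDiagram.mem_iff_lt_rowLen.1 (show (x.1, x.2) ∈ μ from hx)
  simp only [mem_filter, mem_range]
  constructor
  · rintro ⟨h1, h2⟩
    by_contra h
    exact absurd (entry_lt_of_row T (show x.2 < c by omega)
      (YoungDiagram.mem_iff_lt_rowLen.2 h1)) (by simpa using h2)
  · intro h
    refine ⟨by omega, ?_⟩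
    rcases (Nat.lt_succ_iff.1 h).eq_or_lt with rfl | h
    · rfl
    · exact (entry_lt_of_row T h hx).le

/-- The lattice word of a standard tableau: the rows of `n, …, 1`. -/
def tableauWord (T : StandardTableau μ) : List ℕ := wordOf (fun i => (cellAt T i).1) μ.card

theorem tableauWord_mem (T : StandardTableau μ) : tableauWord T ∈ words μ.card μ := by
  rw [mem_words]
  refine ⟨length_wordOf _ _, ?_, fun r => ?_⟩
  · rw [tableauWord, isLattice_wordOf]
    intro k hk r
    rw [count_wordOf, count_wordOf, card_filter_row T hk, card_filter_row T hk]
    refine card_le_card fun c hc => ?_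
    rw [mem_filter, mem_range, ← YoungDiagram.mem_iff_lt_rowLen] at hc ⊢
    exact ⟨μ.up_left_mem (Nat.le_succ r) le_rfl hc.1,
      (entry_lt_of_col T (Nat.lt_succ_self r) hc.1).le.trans hc.2⟩
  · rw [tableauWord, count_wordOf, card_filter_row T le_rfl, filter_true_of_mem, card_range]
    intro c hc
    rw [mem_range, ← YoungDiagram.mem_iff_lt_rowLen] at hc
    exact (mem_Icc.1 (entry_mem T hc)).2

theorem tableauWord_injective : Function.Injective (tableauWord (μ := μ)) := by
  intro T T' h
  rw [tableauWord, tableauWord, wordOf_congr] at h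
  have key : ∀ i ∈ Icc 1 μ.card, cellAt T i = cellAt T' i := by
    intro i hi
    have h1 := card_filter_row_entry T (cellAt_mem T hi)
    have h2 := card_filter_row_entry T' (cellAt_mem T' hi)
    rw [entry_cellAt T hi] at h1
    rw [entry_cellAt T' hi] at h2
    refine Prod.ext (h i hi) ?_
    have : ((Icc 1 i).filter fun j => (cellAt T j).1 = (cellAt T i).1) =
        (Icc 1 i).filter fun j => (cellAt T' j).1 = (cellAt T' i).1 := by
      refine filter_congr fun j hj => ?_
      rw [h i hi, h j (mem_Icc.2 ⟨(mem_Icc.1 hj).1, (mem_Icc.1 hj).2.trans (mem_Icc.1 hi).2⟩)]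
    rw [this] at h1
    omega
  apply Subtype.ext
  rw [← Equiv.symm_bijective.injective.eq_iff]
  ext1 ⟨i, hi⟩
  have := key i hi
  rw [cellAt, cellAt, dif_pos hi, dif_pos hi] at this
  exact Subtype.ext this

theorem exists_tableauWord {w : List ℕ} (hw : w ∈ words μ.card μ) :
    ∃ T : StandardTableau μ, tableauWord T = w := by
  obtain ⟨g, hg⟩ := exists_wordOf w
  obtain ⟨h1, h2, h3⟩ := mem_words.1 hw
  rw [h1] at hg
  subst hg
  rw [isLattice_wordOf] at h2
  simp only [count_wordOf] at h2 h3
  -- Each `i` goes into the first free cell of row `g i`.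
  let col : ℕ → ℕ := fun i => ((Ico 1 i).filter fun j => g j = g i).card
  have hcol : ∀ {i j : ℕ}, 1 ≤ i → i < j → g i = g j → col i < col j := by
    intro i j hi hij hg
    refine card_lt_card (ssubset_iff_of_subset ?_ |>.2 ⟨i, ?_, ?_⟩)
    · intro x hx
      simp only [mem_filter, mem_Ico] at hx ⊢
      exact ⟨⟨hx.1.1, hx.1.2.trans hij⟩, hx.2.trans hg⟩
    · simp only [mem_filter, mem_Ico]
      exact ⟨⟨hi, hij⟩, hg⟩
    · simp
  have hmem : ∀ i ∈ Icc 1 μ.card, (g i, col i) ∈ μ.cells := by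
    intro i hi
    rw [mem_Icc] at hi
    rw [YoungDiagram.mem_cells, YoungDiagram.mem_iff_lt_rowLen, ← h3]
    refine card_lt_card (ssubset_iff_of_subset ?_ |>.2 ⟨i, ?_, ?_⟩)
    · intro x hx
      simp only [mem_filter, mem_Ico, mem_Icc] at hx ⊢
      exact ⟨⟨hx.1.1, by omega⟩, hx.2⟩
    · simp only [mem_filter, mem_Icc]
      exact ⟨hi, trivial⟩
    · simp
  let e : {k // k ∈ Icc 1 μ.card} → {x // x ∈ μ.cells} := fun i => ⟨(g i.1, col i.1), hmem i.1 i.2⟩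
  have he : Function.Bijective e := by
    rw [Fintype.bijective_iff_injective_and_card]
    refine ⟨?_, by simp⟩
    rintro ⟨i, hi⟩ ⟨j, hj⟩ hij
    simp only [e, Subtype.mk.injEq, Prod.mk.injEq] at hij
    rw [mem_Icc] at hi hj
    apply Subtype.ext
    rcases lt_trichotomy i j with h | h | h
    · have := hcol hi.1 h hij.1
      omega
    · exact h
    · have := hcol hj.1 h hij.1.symm
      omega
  let E := Equiv.ofBijective e he
  have hE : ∀ i, (E i).1 = (g i.1, col i.1) := fun i => rfl
  refine ⟨⟨E.symm, ?_, ?_⟩, ?_⟩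
  · intro a b
    obtain ⟨i, rfl⟩ := E.surjective a
    obtain ⟨j, rfl⟩ := E.surjective b
    rw [Equiv.symm_apply_apply, Equiv.symm_apply_apply, hE, hE]
    intro hr hc
    simp only at hr hc
    by_contra h
    rcases (not_lt.1 h).eq_or_lt with h | h
    · rw [h] at hc
      exact lt_irrefl _ hc
    · have := hcol (mem_Icc.1 j.2).1 h hr.symm
      omega
  · intro a b
    obtain ⟨i, rfl⟩ := E.surjective a
    obtain ⟨j, rfl⟩ := E.surjective b
    rw [Equiv.symm_apply_apply, Equiv.symm_apply_apply, hE, hE]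
    intro hc hr
    simp only at hr hc
    by_contra h
    have hi := mem_Icc.1 i.2
    have hj := mem_Icc.1 j.2
    -- If `j ≤ i`, then at time `j` the lower row `g j` holds at most as many entries as the row `g
    -- i`, by the lattice property iterated down the rows. As `j` itself is counted and `i` has not
    -- come earlier, `col j < col i`, contrary to equal columns.
    have hle : ∀ d, ((Icc 1 j.1).filter fun x => g x = g i.1 + d).card ≤
        ((Icc 1 j.1).filter fun x => g x = g i.1).card := by
      intro d
      induction d with
      | zero => rfl
      | succ d ih => exact (h2 j.1 hj.2 (g i.1 + d)).trans ih
    have h4 := hle (g j.1 - g i.1)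
    rw [show g i.1 + (g j.1 - g i.1) = g j.1 by omega] at h4
    have h5 : col j.1 < ((Icc 1 j.1).filter fun x => g x = g j.1).card := by
      refine card_lt_card (ssubset_iff_of_subset ?_ |>.2 ⟨j.1, ?_, ?_⟩)
      · intro x hx
        simp only [mem_filter, mem_Ico, mem_Icc] at hx ⊢
        exact ⟨⟨hx.1.1, by omega⟩, hx.2⟩
      · simp only [mem_filter, mem_Icc]
        exact ⟨⟨hj.1, le_rfl⟩, trivial⟩
      · simp
    have h6 : ((Icc 1 j.1).filter fun x => g x = g i.1).card ≤ col i.1 := by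
      refine card_le_card fun x hx => ?_
      simp only [mem_filter, mem_Ico, mem_Icc] at hx ⊢
      refine ⟨⟨hx.1.1, ?_⟩, hx.2⟩
      rcases (show x ≤ i.1 by omega).eq_or_lt with h | h
      · have : j.1 = i.1 := by omega
        rw [this] at hr
        exact absurd hr (lt_irrefl _)
      · exact h
    omega
  · rw [tableauWord, wordOf_congr]
    intro i hi
    rw [cellAt, dif_pos hi]
    simp only [Equiv.symm_symm, hE]

theorem sum_tableauWord {M : Type*} [AddCommMonoid M] (F : List ℕ → M) :
    ∑ T : StandardTableau μ, F (tableauWord T) = ∑ w ∈ words μ.card μ, F w := by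
  refine sum_nbij tableauWord (fun T _ => tableauWord_mem T) tableauWord_injective.injOn ?_
    fun _ _ => rfl
  intro w hw
  obtain ⟨T, hT⟩ := exists_tableauWord hw
  exact ⟨T, by simp, hT⟩

theorem card_standardTableau : Fintype.card (StandardTableau μ) = numWords μ.card μ := by
  have := sum_tableauWord (μ := μ) (fun _ => 1)
  simpa [numWords] using this

/-- The list begins with the largest entry, so `i` and `i + 1` are compared at index `n - 1 - i`.
The requirement of being weakly west is automatic. -/
theorem hasDescentAt_iff (T : StandardTableau μ) {i : ℕ} (hi : i ∈ Icc 1 (μ.card - 1)) :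
    HasDescentAt T i ↔ ascent (μ.card - 1 - i) (tableauWord T) = true := by
  rw [mem_Icc] at hi
  obtain ⟨m, rfl⟩ := Nat.exists_eq_add_of_le' hi.1
  have hi0 : m + 1 ∈ Icc 1 μ.card := mem_Icc.2 (by omega)
  have hi1 : m + 1 + 1 ∈ Icc 1 μ.card := mem_Icc.2 (by omega)
  have h := ascent_wordOf (fun i => (cellAt T i).1) m (μ.card - 1 - (m + 1))
  rw [show m + 2 + (μ.card - 1 - (m + 1)) = μ.card by omega] at h
  rw [tableauWord, h, decide_eq_true_eq]
  have hcell : ∀ (a : {x // x ∈ μ.cells}) (i : ℕ), (T.1 a).1 = i → cellAt T i = a.1 := by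
    rintro ⟨a, ha⟩ i rfl
    have := cellAt_entry T ha
    rwa [entry, dif_pos ha] at this
  constructor
  · rintro ⟨a, b, ha, hb, h1, -⟩
    rwa [hcell a _ ha, hcell b _ hb]
  · intro hlt
    refine ⟨T.1.symm ⟨_, hi0⟩, T.1.symm ⟨_, hi1⟩, ?_, ?_, ?_, ?_⟩
    · rw [Equiv.apply_symm_apply]
    · rw [Equiv.apply_symm_apply]
    · simpa only [cellAt, dif_pos hi0, dif_pos hi1] using hlt
    · have e0 : (T.1.symm ⟨_, hi0⟩).1 = cellAt T (m + 1) := by rw [cellAt, dif_pos hi0]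
      have e1 : (T.1.symm ⟨_, hi1⟩).1 = cellAt T (m + 1 + 1) := by rw [cellAt, dif_pos hi1]
      rw [e0, e1]
      -- If `i + 1` were strictly south-east of `i`, the cell in the row of `i` and the column of `i
      -- + 1` would hold an entry strictly between them.
      by_contra hc
      push Not at hc
      have m1 : ((cellAt T (m + 1 + 1)).1, (cellAt T (m + 1 + 1)).2) ∈ μ := cellAt_mem T hi1
      have m0 := μ.up_left_mem hlt.le le_rfl m1
      have l0 := entry_lt_of_row T hc m0
      have l1 := entry_lt_of_col T hlt m1
      rw [Prod.mk.eta, entry_cellAt T hi0] at l0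
      rw [Prod.mk.eta, entry_cellAt T hi1] at l1
      omega

theorem descentFun_eq (f : ℕ → ℝ) (T : StandardTableau μ) :
    descentFun f T = ∑ i ∈ Icc 1 (μ.card - 1),
      if ascent (μ.card - 1 - i) (tableauWord T) = true then f i else 0 := by
  rw [← sum_filter, descentFun]
  congr 1
  ext i
  rw [descentSet, mem_filter, mem_filter]
  constructor
  · rintro ⟨h1, h2⟩
    have hi : i ∈ Icc 1 (μ.card - 1) := by
      obtain ⟨a, b, ha, hb, -⟩ := h2
      have := (T.1 b).2
      rw [hb] at this
      simp only [mem_Icc] at this h1 ⊢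
      omega
    exact ⟨hi, (hasDescentAt_iff T hi).1 h2⟩
  · rintro ⟨h1, h2⟩
    refine ⟨?_, (hasDescentAt_iff T h1).2 h2⟩
    simp only [mem_Icc] at h1 ⊢
    omega

end Tableaux

/-! ### Shifted complete homogeneous functions -/

/-- The sum of `x i₁ * (x i₂ - 1) * ⋯ * (x iₖ - k + 1)` over `m > i₁ ≥ i₂ ≥ ⋯ ≥ iₖ`. -/
noncomputable def shiftedHom : ℕ → ℕ → (ℕ → ℝ) → ℝ
  | 0, _, _ => 1
  | k + 1, m, x => ∑ i ∈ range m, x i * shiftedHom k (i + 1) (fun j => x j - 1)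

theorem shiftedHom_succ_succ (k m : ℕ) (x : ℕ → ℝ) :
    shiftedHom (k + 1) (m + 1) x =
      shiftedHom (k + 1) m x + x m * shiftedHom k (m + 1) (fun j => x j - 1) := by
  simp only [shiftedHom, sum_range_succ]

theorem shiftedHom_congr {k m : ℕ} {x x' : ℕ → ℝ} (h : ∀ i < m, x i = x' i) :
    shiftedHom k m x = shiftedHom k m x' := by
  induction k generalizing m x x' with
  | zero => rfl
  | succ k ih =>
    rw [shiftedHom, shiftedHom]
    refine sum_congr rfl fun i hi => ?_
    rw [mem_range] at hi
    rw [h i hi, ih fun j hj => by rw [h j (by omega)]]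

theorem shiftedHom_of_eq_zero {k m : ℕ} {x : ℕ → ℝ} (h : x m = 0) :
    shiftedHom k (m + 1) x = shiftedHom k m x := by
  cases k with
  | zero => rfl
  | succ k => rw [shiftedHom_succ_succ, h, zero_mul, add_zero]

theorem shiftedHom_eq_of_le {k m m' : ℕ} {x : ℕ → ℝ} (hm : m ≤ m')
    (h : ∀ i, m ≤ i → x i = 0) : shiftedHom k m' x = shiftedHom k m x := by
  induction m', hm using Nat.le_induction with
  | base => rfl
  | succ m' hm ih => rw [shiftedHom_of_eq_zero (h _ hm), ih]

/-! ### Generating function in inverse falling factorials -/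

/-- The falling factorial `u (u - 1) ⋯ (u - k + 1)`. -/
noncomputable def falling (u : ℝ) (k : ℕ) : ℝ := ∏ i ∈ range k, (u - i)

theorem falling_zero (u : ℝ) : falling u 0 = 1 := by simp [falling]

theorem falling_succ (u : ℝ) (k : ℕ) : falling u (k + 1) = falling u k * (u - k) := by
  rw [falling, prod_range_succ, falling]

theorem falling_succ' (u : ℝ) (k : ℕ) : falling u (k + 1) = u * falling (u - 1) k := by
  rw [falling, prod_range_succ', falling, mul_comm]
  congr 1
  · simp
  · refine prod_congr rfl fun i _ => ?_
    push_cast; ring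

theorem falling_pos {u : ℝ} {k : ℕ} (h : (k : ℝ) < u + 1) : 0 < falling u k := by
  refine prod_pos fun i hi => ?_
  rw [mem_range] at hi
  have : (i : ℝ) + 1 ≤ k := by exact_mod_cast hi
  linarith

theorem falling_add_one (u : ℝ) (k : ℕ) : falling (u + 1) k * (u + 1 - k) = (u + 1) * falling u k := by
  rw [← falling_succ, falling_succ', add_sub_cancel_right]

/-- The generating function of the shifted complete homogeneous functions. -/
noncomputable def homGen (m : ℕ) (x : ℕ → ℝ) (u : ℝ) : ℝ :=
  ∏ i ∈ range m, (u + i + 1) / (u + i + 1 - x i)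

theorem homGen_congr {m : ℕ} {x x' : ℕ → ℝ} (h : ∀ i < m, x i = x' i) (u : ℝ) :
    homGen m x u = homGen m x' u :=
  prod_congr rfl fun i hi => by rw [h i (mem_range.1 hi)]

theorem homGen_succ (m : ℕ) (x : ℕ → ℝ) (u : ℝ) :
    homGen (m + 1) x u = homGen m x u * ((u + m + 1) / (u + m + 1 - x m)) := by
  rw [homGen, prod_range_succ, ← homGen]

/-- The simultaneous shift leaves all denominators unchanged, and the numerators telescope to `u /
(u + m)`. -/
theorem homGen_pred {m : ℕ} {x : ℕ → ℝ} {u : ℝ} :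
    homGen m (fun j => x j - 1) (u - 1) * (u + m) = u * homGen m x u := by
  induction m with
  | zero => simp [homGen]
  | succ m ih =>
    rw [homGen_succ, homGen_succ, ← mul_assoc, ← ih]
    push_cast
    rw [show u - 1 + m + 1 - (x m - 1) = u + m + 1 - x m by ring]
    ring

/-- Split off the terms whose largest index is the last row: since `(u)_k = u (u - 1)_{k-1}`, they
form the same series for `x - 1` at `u - 1`, with bound `K - 1`, and `homGen_pred` leads back to
`u`. The truncation at `K ≥ y 0` is exact. -/
theorem sum_shiftedHom_div_falling (K m : ℕ) (y : ℕ → ℕ) (hy : Antitone y) (hK : y 0 ≤ K)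
    (u : ℝ) (hu : (K : ℝ) < u) :
    ∑ k ∈ range (K + 1), shiftedHom k m (fun i => y i) / falling u k =
      homGen m (fun i => y i) u := by
  induction K generalizing m y u with
  | zero =>
    have h0 : ∀ i, y i = 0 := fun i => by have := hy (Nat.zero_le i); omega
    have : ∀ i : ℕ, u + i + 1 ≠ 0 := fun i => by
      have : (0 : ℝ) ≤ i := i.cast_nonneg
      push_cast at hu
      positivity
    simp [shiftedHom, falling, homGen, h0, this]
  | succ K ihK =>
    induction m with
    | zero =>
      rw [sum_range_succ']
      simp [shiftedHom, falling, homGen]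
    | succ m ih =>
      have hle : ∀ i, (y i : ℝ) < u := fun i => by
        refine lt_of_le_of_lt ?_ hu
        exact_mod_cast (hy (Nat.zero_le i)).trans hK
      have hm0 : (0 : ℝ) ≤ m := m.cast_nonneg
      have hu0 : 0 < u := lt_of_le_of_lt (by positivity) hu
      -- An empty last row is treated apart: only for `y m > 0` does truncated subtraction give `y i
      -- - 1` on all rows up to `m`.
      by_cases hm : y m = 0
      · have hm' : ∀ k, shiftedHom k (m + 1) (fun i => (y i : ℝ)) =
            shiftedHom k m (fun i => (y i : ℝ)) := fun k => shiftedHom_of_eq_zero (by simp [hm])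
        simp only [hm']
        rw [ih, homGen_succ, hm, Nat.cast_zero, sub_zero, div_self (by positivity), mul_one]
      · rw [sum_range_succ']
        simp only [shiftedHom_succ_succ, falling_succ']
        have hz : shiftedHom 0 (m + 1) (fun i => (y i : ℝ)) =
          shiftedHom 0 m (fun i => (y i : ℝ)) := rfl
        simp only [add_div, sum_add_distrib]
        rw [hz, add_right_comm]
        have e := sum_range_succ' (fun k => shiftedHom k m (fun i => (y i : ℝ)) / falling u k) (K + 1)
        simp only [falling_succ'] at e
        rw [← e, ih]
        have hy1 : Antitone fun i => y i - 1 := fun a b h => Nat.sub_le_sub_right (hy h) 1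
        have e2 := ihK (m + 1) (fun i => y i - 1) hy1 (show y 0 - 1 ≤ K by omega) (u - 1)
          (by push_cast at hu; linarith)
        have hc : ∀ i < m + 1, (((y i - 1 : ℕ) : ℝ)) = (y i : ℝ) - 1 := fun i hi => by
          have := hy (Nat.lt_succ_iff.1 hi)
          rw [Nat.cast_sub (by omega), Nat.cast_one]
        have e3 : ∑ k ∈ range (K + 1), (y m : ℝ) *
            shiftedHom k (m + 1) (fun j => (y j : ℝ) - 1) / (u * falling (u - 1) k) =
            y m / u * homGen (m + 1) (fun j => (y j : ℝ) - 1) (u - 1) := by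
          rw [← homGen_congr hc, ← e2, mul_sum]
          refine sum_congr rfl fun k _ => ?_
          rw [shiftedHom_congr hc]
          rw [mul_div_mul_comm]
        rw [e3]
        have e4 := homGen_pred (m := m + 1) (x := fun j => (y j : ℝ)) (u := u)
        have e5 : homGen (m + 1) (fun j => (y j : ℝ)) u =
            homGen m (fun j => (y j : ℝ)) u * ((u + m + 1) / (u + m + 1 - y m)) :=
          homGen_succ _ _ _
        have h1 : u + m + 1 - y m ≠ 0 := by linarith [hle m]
        have h2 : u + m + 1 ≠ 0 := by positivity
        have e6 : homGen (m + 1) (fun j => (y j : ℝ) - 1) (u - 1) =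
            u * homGen m (fun j => (y j : ℝ)) u / (u + m + 1 - y m) := by
          rw [e5] at e4
          push_cast at e4
          rw [← add_assoc] at e4
          rw [eq_div_iff h1]
          apply mul_right_cancel₀ h2
          calc _ = homGen (m + 1) (fun j => (y j : ℝ) - 1) (u - 1) * (u + m + 1)
                * (u + m + 1 - y m) := by ring
            _ = _ := by rw [e4]; field_simp
        rw [e6, e5]
        field_simp
        ring

/-- Letting `u → ∞` isolates `c 0`. Once it vanishes, replacing `u` by `u + 1` and cancelling the
common factor `1 / (u + 1)` lowers all indices by one. -/
theorem eq_zero_of_sum_div_falling (K : ℕ) (c : ℕ → ℝ)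
    (h : ∀ u : ℝ, (K : ℝ) < u → ∑ k ∈ range (K + 1), c k / falling u k = 0) :
    ∀ k ≤ K, c k = 0 := by
  have hlim : ∀ k : ℕ, Filter.Tendsto (fun u : ℝ => falling u (k + 1)) Filter.atTop Filter.atTop := by
    intro k
    induction k with
    | zero =>
      have : (fun u : ℝ => falling u (0 + 1)) = id := by
        funext u
        simp [falling]
      rw [this]
      exact Filter.tendsto_id
    | succ k ih =>
      simp only [falling_succ _ (k + 1)]
      exact ih.atTop_mul_atTop₀ (Filter.tendsto_atTop_add_const_right _ _ Filter.tendsto_id)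
  have h0 : ∀ (K : ℕ) (c : ℕ → ℝ),
      (∀ u : ℝ, (K : ℝ) < u → ∑ k ∈ range (K + 1), c k / falling u k = 0) → c 0 = 0 := by
    intro K c h
    have h1 : Filter.Tendsto (fun u : ℝ => ∑ k ∈ range K, c (k + 1) / falling u (k + 1) + c 0)
        Filter.atTop (nhds (∑ k ∈ range K, (0 : ℝ) + c 0)) :=
      (tendsto_finsetSum _ fun k _ => (tendsto_const_nhds.div_atTop (hlim k))).add_const _
    have h2 : (fun u : ℝ => ∑ k ∈ range K, c (k + 1) / falling u (k + 1) + c 0)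
        =ᶠ[Filter.atTop] fun _ => 0 := by
      filter_upwards [Filter.eventually_gt_atTop (K : ℝ)] with u hu
      have := h u hu
      rwa [sum_range_succ', falling_zero, div_one] at this
    have := tendsto_nhds_unique h1 ((Filter.tendsto_congr' h2).2 tendsto_const_nhds)
    simpa using this
  induction K generalizing c with
  | zero =>
    intro k hk
    obtain rfl : k = 0 := by omega
    exact h0 0 c h
  | succ K ih =>
    have hc0 := h0 _ c h
    intro k hk
    cases k with
    | zero => exact hc0
    | succ k =>
      refine ih (fun k => c (k + 1)) (fun u hu => ?_) k (by omega)
      have h1 := h (u + 1) (by push_cast; linarith)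
      have hu0 : u + 1 ≠ 0 := by
        have : (0 : ℝ) ≤ K := K.cast_nonneg
        linarith
      rw [sum_range_succ', hc0, zero_div, add_zero] at h1
      simp only [falling_succ', add_sub_cancel_right] at h1
      have h2 : ∑ k ∈ range (K + 1), c (k + 1) / ((u + 1) * falling u k) =
          (u + 1)⁻¹ * ∑ k ∈ range (K + 1), c (k + 1) / falling u k := by
        rw [mul_sum]
        refine sum_congr rfl fun k _ => ?_
        rw [inv_mul_eq_div, div_div, mul_comm]
      rw [h2] at h1
      exact (mul_eq_zero.1 h1).resolve_left (inv_ne_zero hu0)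

/-! ### Partial fractions and removal of a cell -/

/-- The residue weight `l i * ∏_{j ≠ i} (l i - l j - 1) / (l i - l j)`. -/
noncomputable def weight (s : Finset ℕ) (l : ℕ → ℝ) (i : ℕ) : ℝ :=
  l i * ∏ j ∈ s.erase i, (l i - l j - 1) / (l i - l j)

/-- This is the partial fraction expansion of `z ∏ (z - l j - 1) / (z - l j)`, whose polynomial part
is `z - |s|` and whose residue at `l i` is minus the weight. -/
theorem sum_weight_div (s : Finset ℕ) (l : ℕ → ℝ) (hl : Set.InjOn l s) (z : ℝ)
    (hz : ∀ i ∈ s, z ≠ l i) :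
    ∑ i ∈ s, weight s l i / (z - l i) =
      z - s.card - z * ∏ j ∈ s, (z - l j - 1) / (z - l j) := by
  induction s using Finset.induction_on generalizing z with
  | empty => simp
  | insert a s ha ih =>
    have hs : Set.InjOn l s := hl.mono (by simp)
    have hne : ∀ i ∈ s, l i - l a ≠ 0 := fun i hi h => ha (by
      rwa [← hl (by simp [hi]) (by simp) (sub_eq_zero.1 h)])
    have e1 := ih hs z fun i hi => hz i (mem_insert_of_mem hi)
    -- The induction hypothesis at the new node `l a` itself evaluates the weight of `a`.
    have e2 := ih hs (l a) fun i hi h => hne i hi (by rw [h, sub_self])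
    have hza : z - l a ≠ 0 := sub_ne_zero.2 (hz a (mem_insert_self a s))
    have wa : weight (insert a s) l a = l a - s.card - ∑ i ∈ s, weight s l i / (l a - l i) := by
      rw [e2, weight, erase_insert ha]
      ring
    have wi : ∀ i ∈ s, weight (insert a s) l i =
        weight s l i * ((l i - l a - 1) / (l i - l a)) := by
      intro i hi
      have hia : a ≠ i := fun h => ha (h ▸ hi)
      rw [weight, erase_insert_of_ne hia, prod_insert (fun h => ha (mem_of_mem_erase h)), weight]
      ring
    rw [sum_insert ha, prod_insert ha, wa, card_insert_of_notMem ha]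
    have e3 : ∑ i ∈ s, weight (insert a s) l i / (z - l i) =
        (z - l a - 1) / (z - l a) * ∑ i ∈ s, weight s l i / (z - l i) +
          1 / (z - l a) * ∑ i ∈ s, weight s l i / (l a - l i) := by
      rw [mul_sum, mul_sum, ← sum_add_distrib]
      refine sum_congr rfl fun i hi => ?_
      rw [wi i hi]
      have h1 := hne i hi
      have h2 : l a - l i ≠ 0 := fun h => h1 (by linarith)
      have h3 : z - l i ≠ 0 := sub_ne_zero.2 (hz i (mem_insert_of_mem hi))
      rw [← neg_sub (l i) (l a)]
      field_simp
      ring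
    rw [e3, e1]
    push_cast
    field_simp
    ring

/-- The shifted row length `x i + m - 1 - i`. -/
def shiftedRow (m : ℕ) (x : ℕ → ℝ) (i : ℕ) : ℝ := x i + m - 1 - i

theorem homGen_update {m r : ℕ} (hr : r < m) (x : ℕ → ℝ) (u : ℝ) (h1 : u + r + 1 - x r ≠ 0) :
    homGen m (Function.update x r (x r - 1)) u =
      homGen m x u * ((u + r + 1 - x r) / (u + r + 1 - x r + 1)) := by
  rw [homGen, homGen, ← mul_prod_erase _ _ (mem_range.2 hr), ← mul_prod_erase (range m)
    (fun i : ℕ => (u + i + 1) / (u + i + 1 - x i)) (mem_range.2 hr)]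
  rw [prod_congr rfl (g := fun i : ℕ => (u + i + 1) / (u + i + 1 - x i)) (fun i hi => by
    rw [Function.update_of_ne (ne_of_mem_erase hi)])]
  rw [Function.update_self, show u + r + 1 - (x r - 1) = u + r + 1 - x r + 1 by ring]
  field_simp

theorem homGen_add_one {m : ℕ} {x : ℕ → ℝ} {u : ℝ} (hu : 0 ≤ u) (hx : ∀ i < m, x i < u + i + 1) :
    homGen m x u * ((u + m + 1) * ∏ j ∈ range m, (u + j + 1 - x j) / (u + j + 1 - x j + 1)) =
      (u + 1) * homGen m x (u + 1) := by
  induction m with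
  | zero => simp [homGen]
  | succ m ih =>
    have ih := ih fun i hi => hx i (by omega)
    rw [homGen_succ, homGen_succ, prod_range_succ, ← mul_assoc (u + 1), ← ih]
    have h1 : u + m + 1 - x m ≠ 0 := by linarith [hx m (by omega)]
    have h2 : u + m + 1 - x m + 1 ≠ 0 := by linarith [hx m (by omega)]
    have h3 : u + 1 + m + 1 - x m ≠ 0 := by linarith [hx m (by omega)]
    rw [show u + 1 + m + 1 - x m = u + m + 1 - x m + 1 by ring]
    push_cast
    field_simp
    ring

/-- With `z = u + m + 1`, removing a cell from row `r` multiplies the generating function by `1 - 1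
/ (z - l r)`. The sum is therefore the partial fraction expansion at `z`, and the product in it
telescopes against `homGen` by `homGen_add_one`. -/
theorem sum_weight_homGen {m : ℕ} {x : ℕ → ℝ} {u : ℝ} (hu : 0 ≤ u) (hx : ∀ i < m, x i < u + i + 1)
    (hl : Set.InjOn (shiftedRow m x) (range m)) :
    ∑ r ∈ range m, weight (range m) (shiftedRow m x) r *
      (homGen m x u - homGen m (Function.update x r (x r - 1)) u) =
      (u + 1) * (homGen m x u - homGen m x (u + 1)) := by
  have hz : ∀ i ∈ range m, u + m + 1 ≠ shiftedRow m x i := fun i hi => by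
    have := hx i (mem_range.1 hi)
    rw [shiftedRow]
    intro h
    linarith
  have h := sum_weight_div (range m) (shiftedRow m x) hl (u + m + 1) hz
  have e1 : ∏ j ∈ range m, (u + m + 1 - shiftedRow m x j - 1) / (u + m + 1 - shiftedRow m x j) =
      ∏ j ∈ range m, (u + j + 1 - x j) / (u + j + 1 - x j + 1) := by
    refine prod_congr rfl fun j _ => ?_
    rw [shiftedRow]
    congr 1 <;> ring
  rw [e1, card_range] at h
  have e2 : ∑ r ∈ range m, weight (range m) (shiftedRow m x) r *
      (homGen m x u - homGen m (Function.update x r (x r - 1)) u) =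
      homGen m x u * ∑ r ∈ range m,
        weight (range m) (shiftedRow m x) r / (u + m + 1 - shiftedRow m x r) := by
    rw [mul_sum]
    refine sum_congr rfl fun r hr => ?_
    have h1 := hx r (mem_range.1 hr)
    have h2 : u + r + 1 - x r + 1 ≠ 0 := by linarith
    rw [homGen_update (mem_range.1 hr) x u (by linarith),
      show u + m + 1 - shiftedRow m x r = u + r + 1 - x r + 1 by rw [shiftedRow]; ring]
    field_simp
    ring
  rw [e2, h, mul_sub (u + 1), ← homGen_add_one hu hx]
  ring

theorem shiftedRow_strictAnti (m : ℕ) {y : ℕ → ℕ} (hy : Antitone y) :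
    StrictAnti (shiftedRow m fun i => (y i : ℝ)) := by
  intro a b h
  have h1 : (y b : ℝ) ≤ y a := by exact_mod_cast hy h.le
  have h2 : (a : ℝ) < b := by exact_mod_cast h
  simp only [shiftedRow]
  linarith

/-- Rows without a corner do not contribute: two equal rows give a factor `l r - l (r + 1) - 1 = 0`,
and an empty last row gives `l r = 0`. -/
theorem weight_eq_zero {m r : ℕ} {y : ℕ → ℕ} (hy : Antitone y) (hm : y m = 0) (hr : r < m)
    (h : ¬ y (r + 1) < y r) :
    weight (range m) (shiftedRow m fun i => (y i : ℝ)) r = 0 := by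
  have h1 : y (r + 1) = y r := le_antisymm (hy (Nat.le_succ r)) (not_lt.1 h)
  rcases (show r + 1 ≤ m by omega).eq_or_lt with h2 | h2
  · rw [weight, shiftedRow, ← h1, h2, hm, ← h2]
    push_cast
    ring
  · rw [weight, prod_eq_zero (i := r + 1), mul_zero]
    · simp [h2]
    · simp only [shiftedRow, h1]
      push_cast
      ring

theorem cast_update_pred {y : ℕ → ℕ} {r : ℕ} (h : 0 < y r) :
    (fun i => ((Function.update y r (y r - 1) i : ℕ) : ℝ)) =
      Function.update (fun i => (y i : ℝ)) r ((y r : ℝ) - 1) := by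
  funext i
  by_cases hi : i = r
  · subst hi
    rw [Function.update_self, Function.update_self, Nat.cast_sub h, Nat.cast_one]
  · rw [Function.update_of_ne hi, Function.update_of_ne hi]

theorem antitone_update_pred {y : ℕ → ℕ} (hy : Antitone y) {r : ℕ} (h : y (r + 1) < y r) :
    Antitone (Function.update y r (y r - 1)) := by
  refine antitone_nat_of_succ_le fun i => ?_
  have h1 := hy (Nat.le_succ i)
  by_cases hi : i = r
  · subst hi
    rw [Function.update_self, Function.update_of_ne (by omega)]
    omega
  · rw [Function.update_of_ne hi]
    by_cases hi' : i + 1 = r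
    · subst hi'
      rw [Function.update_self]
      exact (Nat.sub_le _ _).trans h1
    · rw [Function.update_of_ne hi']
      exact h1

/-- Compare the coefficients of `1 / (u)_k` in `sum_weight_homGen`; on the right, `(u + 1) (1 /
(u)_k - 1 / (u + 1)_k) = k / (u)_k`. -/
theorem sum_weight_shiftedHom {m : ℕ} {y : ℕ → ℕ} (hy : Antitone y) (hm : y m = 0) (k : ℕ) :
    ∑ r ∈ range m with y (r + 1) < y r, weight (range m) (shiftedRow m fun i => (y i : ℝ)) r *
      (shiftedHom k m (fun i => (y i : ℝ)) -
        shiftedHom k m (fun i => ((Function.update y r (y r - 1) i : ℕ) : ℝ))) =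
      k * shiftedHom k m (fun i => (y i : ℝ)) := by
  rw [← sub_eq_zero]
  set W := weight (range m) (shiftedRow m fun i => (y i : ℝ)) with hW
  -- The cutoff must reach `k` and also dominate `y 0`, so that every expansion involved is
  -- complete.
  refine eq_zero_of_sum_div_falling (max k (y 0)) (fun k =>
    ∑ r ∈ range m with y (r + 1) < y r, W r *
      (shiftedHom k m (fun i => (y i : ℝ)) -
        shiftedHom k m (fun i => ((Function.update y r (y r - 1) i : ℕ) : ℝ))) -
      k * shiftedHom k m (fun i => (y i : ℝ))) (fun u hu => ?_) k (le_max_left _ _)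
  have hu0 : 0 ≤ u := (Nat.cast_nonneg _).trans hu.le
  have hx : ∀ i < m, (y i : ℝ) < u + i + 1 := fun i _ => by
    have h1 : (y i : ℝ) ≤ (max k (y 0) : ℕ) := by
      exact_mod_cast (hy (Nat.zero_le i)).trans (le_max_right _ _)
    have h2 : (0 : ℝ) ≤ i := i.cast_nonneg
    linarith
  have key := sum_weight_homGen hu0 hx (shiftedRow_strictAnti m hy).injective.injOn
  rw [← hW] at key
  set K := max k (y 0) with hK
  have hKy : y 0 ≤ K := le_max_right _ _
  have hfall : ∀ j ∈ range (K + 1), falling u j ≠ 0 := fun j hj => by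
    refine (falling_pos ?_).ne'
    have : (j : ℝ) ≤ K := by exact_mod_cast Nat.lt_succ_iff.1 (mem_range.1 hj)
    linarith
  have lhs : ∑ r ∈ range m, W r * (homGen m (fun i => (y i : ℝ)) u -
      homGen m (Function.update (fun i => (y i : ℝ)) r ((y r : ℝ) - 1)) u) =
      ∑ j ∈ range (K + 1), (∑ r ∈ range m with y (r + 1) < y r, W r *
      (shiftedHom j m (fun i => (y i : ℝ)) -
        shiftedHom j m (fun i => ((Function.update y r (y r - 1) i : ℕ) : ℝ)))) / falling u j := by
    simp only [sum_div]
    rw [sum_comm, ← sum_filter_add_sum_filter_not (range m) (fun r => y (r + 1) < y r)]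
    rw [sum_eq_zero (s := filter (fun r => ¬ y (r + 1) < y r) (range m)), add_zero]
    · refine sum_congr rfl fun r hr => ?_
      rw [mem_filter, mem_range] at hr
      rw [← cast_update_pred (by omega), ← sum_shiftedHom_div_falling K m y hy hKy u hu,
        ← sum_shiftedHom_div_falling K m _ (antitone_update_pred hy hr.2) _ u hu,
        ← sum_sub_distrib, mul_sum]
      · refine sum_congr rfl fun j _ => ?_
        ring
      · refine le_trans ?_ hKy
        by_cases h : 0 = r
        · rw [← h, Function.update_self]
          exact Nat.sub_le _ _
        · rw [Function.update_of_ne h]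
    · intro r hr
      rw [mem_filter, mem_range] at hr
      rw [hW, weight_eq_zero hy hm hr.1 hr.2, zero_mul]
  have rhs : (u + 1) * (homGen m (fun i => (y i : ℝ)) u - homGen m (fun i => (y i : ℝ)) (u + 1)) =
      ∑ j ∈ range (K + 1), (j * shiftedHom j m (fun i => (y i : ℝ))) / falling u j := by
    rw [← sum_shiftedHom_div_falling K m y hy hKy u hu,
      ← sum_shiftedHom_div_falling K m y hy hKy (u + 1) (by linarith), ← sum_sub_distrib, mul_sum]
    refine sum_congr rfl fun j hj => ?_
    have h1 := falling_add_one u j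
    have h2 := hfall j hj
    have hj' : (j : ℝ) ≤ K := by exact_mod_cast Nat.lt_succ_iff.1 (mem_range.1 hj)
    have h3 : falling (u + 1) j ≠ 0 := (falling_pos (by linarith)).ne'
    have h4 : (u + 1) / falling (u + 1) j = (u + 1 - j) / falling u j := by
      rw [div_eq_div_iff h3 h2]
      linarith
    calc _ = (u + 1) * shiftedHom j m (fun i => (y i : ℝ)) / falling u j -
          (u + 1) / falling (u + 1) j * shiftedHom j m (fun i => (y i : ℝ)) := by ring
      _ = _ := by rw [h4]; ring
  rw [lhs, rhs, ← sub_eq_zero, ← sum_sub_distrib] at key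
  rw [← key]
  exact sum_congr rfl fun j _ => sub_div _ _ _

theorem shiftedHom_one (m : ℕ) (x : ℕ → ℝ) : shiftedHom 1 m x = ∑ i ∈ range m, x i := by
  simp [shiftedHom]

theorem sum_weight {m : ℕ} {y : ℕ → ℕ} (hy : Antitone y) (hm : y m = 0) :
    ∑ r ∈ range m with y (r + 1) < y r, weight (range m) (shiftedRow m fun i => (y i : ℝ)) r =
      ∑ i ∈ range m, (y i : ℝ) := by
  have h := sum_weight_shiftedHom hy hm 1
  simp only [shiftedHom_one, Nat.cast_one, one_mul] at h
  rw [← h]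
  refine sum_congr rfl fun r hr => ?_
  rw [mem_filter, mem_range] at hr
  rw [← sum_sub_distrib, sum_eq_single r, Function.update_self, Nat.cast_sub (by omega)]
  · simp
  · intro i _ hi
    rw [Function.update_of_ne hi, sub_self]
  · intro h
    exact absurd (mem_range.2 hr.1) h

/-! ### The hook length formula -/

/-- The hook length of the cell `(i, j)`. -/
noncomputable def hook (μ : YoungDiagram) (i j : ℕ) : ℝ :=
  (μ.rowLen i : ℝ) + (μ.colLen j : ℝ) - ((i : ℝ) + 1) - ((j : ℝ) + 1) + 1

/-- The product of the hook lengths in row `i`. -/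
noncomputable def rowHooks (μ : YoungDiagram) (i : ℕ) : ℝ := ∏ j ∈ range (μ.rowLen i), hook μ i j

theorem rowLen_eq_zero {μ : YoungDiagram} {m i : ℕ} (hm : μ.rowLen m = 0) (hi : m ≤ i) :
    μ.rowLen i = 0 := by
  have := μ.rowLen_anti m i hi
  omega

theorem prod_cells {μ : YoungDiagram} {m : ℕ} (hm : μ.rowLen m = 0) :
    ∏ x ∈ μ.cells, hook μ x.1 x.2 = ∏ i ∈ range m, rowHooks μ i := by
  refine prod_finset_product _ _ _ ?_
  rintro ⟨i, j⟩
  simp only [YoungDiagram.mem_cells, YoungDiagram.mem_iff_lt_rowLen, mem_range]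
  refine ⟨fun h => ⟨?_, h⟩, fun h => h.2⟩
  by_contra hi
  have := rowLen_eq_zero hm (not_lt.1 hi)
  omega

theorem sum_rowLen {μ : YoungDiagram} {m : ℕ} (hm : μ.rowLen m = 0) :
    ∑ i ∈ range m, μ.rowLen i = μ.card := by
  rw [YoungDiagram.card, card_eq_sum_ones, sum_finset_product _ (range m)
    (fun i => range (μ.rowLen i))]
  · simp
  · rintro ⟨i, j⟩
    simp only [YoungDiagram.mem_cells, YoungDiagram.mem_iff_lt_rowLen, mem_range]
    refine ⟨fun h => ⟨?_, h⟩, fun h => h.2⟩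
    by_contra hi
    have := rowLen_eq_zero hm (not_lt.1 hi)
    omega

/-- The hook lengths `a j` of row `r` and the differences `b k = l r - l k` for `k > r` together are
exactly the numbers `1, …, l r`. -/
theorem rowHooks_mul {μ : YoungDiagram} {m r : ℕ} (hm : μ.rowLen m = 0) (hr : r < m) :
    rowHooks μ r * ∏ k ∈ Ioo r m, (shiftedRow m (fun i => (μ.rowLen i : ℝ)) r -
      shiftedRow m (fun i => (μ.rowLen i : ℝ)) k) =
      ((μ.rowLen r + (m - 1 - r)).factorial : ℝ) := by
  have hcol : ∀ j < μ.rowLen r, r < μ.colLen j := fun j hj => by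
    rwa [← YoungDiagram.mem_iff_lt_colLen, YoungDiagram.mem_iff_lt_rowLen]
  have hcolm : ∀ j, μ.colLen j ≤ m := fun j => by
    by_contra h
    have := YoungDiagram.mem_iff_lt_rowLen.1 (YoungDiagram.mem_iff_lt_colLen.2 (not_le.1 h))
    omega
  let a : ℕ → ℕ := fun j => μ.rowLen r - j + (μ.colLen j - r) - 1
  let b : ℕ → ℕ := fun k => μ.rowLen r - μ.rowLen k + (k - r)
  have ha : Set.InjOn a (range (μ.rowLen r)) := by
    have key : ∀ i j, i < j → j < μ.rowLen r → a j < a i := fun i j hij hj => by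
      have h1 := μ.colLen_anti i j hij.le
      have h2 := hcol j hj
      simp only [a]
      omega
    intro i hi j hj hij
    simp only [coe_range, Set.mem_Iio] at hi hj
    rcases lt_trichotomy i j with h | h | h
    · exact absurd hij (key i j h hj).ne'
    · exact h
    · exact absurd hij (key j i h hi).ne
  have hb : Set.InjOn b (Ioo r m) := by
    have key : ∀ i j, r < i → i < j → b i < b j := fun i j hi hij => by
      have h1 := μ.rowLen_anti i j hij.le
      have h2 := μ.rowLen_anti r i hi.le
      simp only [b]
      omega
    intro i hi j hj hij
    simp only [coe_Ioo, Set.mem_Ioo] at hi hj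
    rcases lt_trichotomy i j with h | h | h
    · exact absurd hij (key i j hi.1 h).ne
    · exact h
    · exact absurd hij (key j i hj.1 h).ne'
  have hdisj : Disjoint ((range (μ.rowLen r)).image a) ((Ioo r m).image b) := by
    rw [disjoint_left]
    intro x hx hx'
    simp only [mem_image, mem_range, mem_Ioo] at hx hx'
    obtain ⟨j, hj, rfl⟩ := hx
    obtain ⟨k, hk, hkj⟩ := hx'
    have h1 := hcol j hj
    have h2 := μ.rowLen_anti r k hk.1.le
    have h3 : j < μ.rowLen k ↔ k < μ.colLen j := by
      rw [← YoungDiagram.mem_iff_lt_rowLen, YoungDiagram.mem_iff_lt_colLen]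
    simp only [a, b] at hkj
    -- If `(k, j)` is a cell, then `a j > b k`; otherwise `a j < b k`.
    by_cases h : j < μ.rowLen k
    · have := h3.1 h
      omega
    · have := mt h3.2 h
      omega
  have hunion : (range (μ.rowLen r)).image a ∪ (Ioo r m).image b =
      Ico 1 (μ.rowLen r + (m - 1 - r) + 1) := by
    apply eq_of_subset_of_card_le
    · intro x hx
      rw [mem_union, mem_image, mem_image] at hx
      rcases hx with ⟨j, hj, rfl⟩ | ⟨k, hk, rfl⟩
      · rw [mem_range] at hj
        have h1 := hcol j hj
        have h2 := hcolm j
        simp only [a, mem_Ico]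
        omega
      · rw [mem_Ioo] at hk
        simp only [b, mem_Ico]
        omega
    · rw [card_union_of_disjoint hdisj, card_image_of_injOn ha, card_image_of_injOn hb]
      simp only [Nat.card_Ico, card_range, Nat.card_Ioo]
      omega
  rw [← prod_Ico_id_eq_factorial, ← hunion, prod_union hdisj, prod_image ha, prod_image hb]
  push_cast
  congr 1
  · refine prod_congr rfl fun j hj => ?_
    rw [mem_range] at hj
    have h1 := hcol j hj
    have : a j + (r + 1) + j = μ.rowLen r + μ.colLen j := by
      simp only [a]
      omega
    have : (a j : ℝ) + (r + 1) + j = μ.rowLen r + μ.colLen j := by exact_mod_cast this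
    rw [hook]
    linarith
  · refine prod_congr rfl fun k hk => ?_
    rw [mem_Ioo] at hk
    have h2 := μ.rowLen_anti r k hk.1.le
    have : b k + r + μ.rowLen k = μ.rowLen r + k := by
      simp only [b]
      omega
    have : (b k : ℝ) + r + μ.rowLen k = μ.rowLen r + k := by exact_mod_cast this
    simp only [shiftedRow]
    linarith

theorem range_erase_eq (m : ℕ) {r : ℕ} (hr : r < m) : (range m).erase r = range r ∪ Ioo r m := by
  ext i
  simp only [mem_erase, mem_range, mem_union, mem_Ioo]
  omega

theorem prod_range_erase (m : ℕ) {r : ℕ} (hr : r < m) (g : ℕ → ℝ) :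
    ∏ i ∈ (range m).erase r, g i = (∏ i ∈ range r, g i) * ∏ i ∈ Ioo r m, g i := by
  rw [range_erase_eq m hr, prod_union]
  rw [disjoint_left]
  intro i hi
  simp only [mem_range, mem_Ioo] at hi ⊢
  omega

theorem lt_of_mem_corners {μ : YoungDiagram} {m : ℕ} (hm : μ.rowLen m = 0) {c : ℕ × ℕ}
    (hc : c ∈ corners μ) : c.1 < m := by
  by_contra h
  have h1 := rowLen_eq_zero hm (not_lt.1 h)
  have h2 := (mem_corners_iff.1 hc).1
  omega

theorem rowLen_remove_eq_update {μ : YoungDiagram} {c : ℕ × ℕ} (hc : c ∈ corners μ) :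
    (remove μ c).rowLen = Function.update μ.rowLen c.1 (μ.rowLen c.1 - 1) := by
  funext i
  rw [rowLen_remove hc]
  by_cases h : i = c.1
  · rw [if_pos h, h, Function.update_self]
  · rw [if_neg h, Function.update_of_ne h]

theorem rowLen_remove_eq_zero {μ : YoungDiagram} {m : ℕ} (hm : μ.rowLen m = 0) {c : ℕ × ℕ}
    (hc : c ∈ corners μ) : (remove μ c).rowLen m = 0 := by
  rw [rowLen_remove hc, hm, Nat.zero_sub, ite_self]

theorem antitone_rowLen (μ : YoungDiagram) : Antitone μ.rowLen := fun a b h => μ.rowLen_anti a b h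

/-- The weight of the row `r` in the partition `μ` with at most `m` parts. -/
noncomputable def rowWeight (m : ℕ) (μ : YoungDiagram) (r : ℕ) : ℝ :=
  weight (range m) (shiftedRow m fun i => (μ.rowLen i : ℝ)) r

/-- In terms of `rowHooks_mul`, removing the corner only lowers `l r` by one. Rows below are
unaffected, each row above contributes its factor of the weight, and row `r` contributes the
remaining factors together with `l r`. -/
theorem prod_hook_remove {μ : YoungDiagram} {m : ℕ} (hm : μ.rowLen m = 0) {c : ℕ × ℕ}
    (hc : c ∈ corners μ) :
    ∏ x ∈ μ.cells, hook μ x.1 x.2 =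
      rowWeight m μ c.1 * ∏ x ∈ (remove μ c).cells, hook (remove μ c) x.1 x.2 := by
  have hm' := rowLen_remove_eq_zero hm hc
  have hr := lt_of_mem_corners hm hc
  have hlen := (mem_corners_iff.1 hc).1
  rw [prod_cells hm, prod_cells hm', ← mul_prod_erase _ _ (mem_range.2 hr),
    ← mul_prod_erase _ (fun i => rowHooks (remove μ c) i) (mem_range.2 hr), prod_range_erase m hr,
    prod_range_erase m hr, rowWeight, weight, prod_range_erase m hr]
  set r := c.1 with hrdef
  set l := shiftedRow m fun i => (μ.rowLen i : ℝ) with hl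
  set l' := shiftedRow m fun i => ((remove μ c).rowLen i : ℝ) with hl'
  have hlr : l' r = l r - 1 := by
    simp only [hl, hl', shiftedRow, rowLen_remove hc, ← hrdef, if_true]
    rw [Nat.cast_sub (by omega), Nat.cast_one]
    ring
  have hli : ∀ i, i ≠ r → l' i = l i := fun i hi => by
    simp only [hl, hl', shiftedRow, rowLen_remove hc, ← hrdef, if_neg hi]
  have hleni : ∀ i, i ≠ r → (remove μ c).rowLen i = μ.rowLen i := fun i hi => by
    rw [rowLen_remove hc, ← hrdef, if_neg hi]
  have hanti : StrictAnti l := shiftedRow_strictAnti m (antitone_rowLen μ)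
  have hanti' : StrictAnti l' := shiftedRow_strictAnti m (antitone_rowLen (remove μ c))
  have hV : ∀ i, ∏ k ∈ Ioo i m, (l i - l k) ≠ 0 := fun i => by
    refine prod_ne_zero_iff.2 fun k hk => ?_
    exact (sub_pos.2 (hanti (mem_Ioo.1 hk).1)).ne'
  have hV' : ∀ i, ∏ k ∈ Ioo i m, (l' i - l' k) ≠ 0 := fun i => by
    refine prod_ne_zero_iff.2 fun k hk => ?_
    exact (sub_pos.2 (hanti' (mem_Ioo.1 hk).1)).ne'
  have hbelow : ∀ i ∈ Ioo r m, rowHooks μ i = rowHooks (remove μ c) i := by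
    intro i hi
    rw [mem_Ioo] at hi
    have h1 := rowHooks_mul hm hi.2
    have h2 := rowHooks_mul hm' hi.2
    rw [← hl] at h1
    rw [← hl', hleni i (by omega), ← h1] at h2
    have h3 : ∏ k ∈ Ioo i m, (l' i - l' k) = ∏ k ∈ Ioo i m, (l i - l k) := by
      refine prod_congr rfl fun k hk => ?_
      rw [mem_Ioo] at hk
      rw [hli i (by omega), hli k (by omega)]
    rw [h3] at h2
    exact (mul_right_cancel₀ (hV i) h2).symm
  have habove : ∀ i ∈ range r, rowHooks μ i =
      (l r - l i - 1) / (l r - l i) * rowHooks (remove μ c) i := by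
    intro i hi
    rw [mem_range] at hi
    have h1 := rowHooks_mul hm (hi.trans hr)
    have h2 := rowHooks_mul hm' (hi.trans hr)
    rw [← hl] at h1
    rw [← hl', hleni i (by omega), ← h1] at h2
    have hrm : r ∈ Ioo i m := mem_Ioo.2 ⟨hi, hr⟩
    have e : ∏ k ∈ (Ioo i m).erase r, (l' i - l' k) = ∏ k ∈ (Ioo i m).erase r, (l i - l k) := by
      refine prod_congr rfl fun k hk => ?_
      rw [hli i (by omega), hli k (ne_of_mem_erase hk)]
    have h0 := hV i
    rw [← mul_prod_erase _ _ hrm] at h0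
    rw [← mul_prod_erase _ _ hrm, ← mul_prod_erase _ (fun k => l i - l k) hrm, e, hlr,
      hli i (by omega), ← mul_assoc, ← mul_assoc] at h2
    have h3 := mul_right_cancel₀ (right_ne_zero_of_mul h0) h2
    have h4 : l r - l i ≠ 0 := (sub_neg.2 (hanti hi)).ne
    rw [div_mul_eq_mul_div, eq_div_iff h4]
    linarith
  have hself : rowHooks μ r =
      l r * (∏ k ∈ Ioo r m, (l r - l k - 1) / (l r - l k)) * rowHooks (remove μ c) r := by
    have h1 := rowHooks_mul hm hr
    have h2 := rowHooks_mul hm' hr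
    rw [← hl] at h1
    have e : ∏ k ∈ Ioo r m, (l' r - l' k) = ∏ k ∈ Ioo r m, (l r - l k - 1) := by
      refine prod_congr rfl fun k hk => ?_
      rw [mem_Ioo] at hk
      rw [hlr, hli k (by omega)]
      ring
    rw [← hl', rowLen_remove hc, if_pos hrdef, e] at h2
    have e2 : μ.rowLen r + (m - 1 - r) = (μ.rowLen r - 1 + (m - 1 - r)) + 1 := by omega
    have e3 : l r = ((μ.rowLen r - 1 + (m - 1 - r) + 1 : ℕ) : ℝ) := by
      rw [← e2, hl, shiftedRow]
      have : m - 1 - r + r + 1 = m := by omega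
      have : ((m - 1 - r : ℕ) : ℝ) + r + 1 = m := by exact_mod_cast this
      push_cast
      linarith
    rw [e2, Nat.factorial_succ, Nat.cast_mul, ← e3, ← h2] at h1
    rw [prod_div_distrib]
    have := hV r
    field_simp
    linarith
  rw [prod_congr rfl hbelow, prod_congr rfl habove, hself, prod_mul_distrib]
  ring

theorem hook_pos {μ : YoungDiagram} {x : ℕ × ℕ} (hx : x ∈ μ.cells) : 0 < hook μ x.1 x.2 := by
  have h1 : x.2 + 1 ≤ μ.rowLen x.1 := YoungDiagram.mem_iff_lt_rowLen.1 hx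
  have h2 : x.1 + 1 ≤ μ.colLen x.2 := YoungDiagram.mem_iff_lt_colLen.1 hx
  have h1' : (x.2 : ℝ) + 1 ≤ μ.rowLen x.1 := by exact_mod_cast h1
  have h2' : (x.1 : ℝ) + 1 ≤ μ.colLen x.2 := by exact_mod_cast h2
  rw [hook]
  linarith

theorem hookNumber_eq (μ : YoungDiagram) :
    hookNumber μ = μ.card.factorial / ∏ x ∈ μ.cells, hook μ x.1 x.2 := by
  rw [hookNumber, prod_inv_distrib, div_eq_mul_inv]
  rfl

theorem hookNumber_pos (μ : YoungDiagram) : 0 < hookNumber μ := by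
  rw [hookNumber_eq]
  exact div_pos (by exact_mod_cast Nat.factorial_pos _) (prod_pos fun x hx => hook_pos hx)

theorem hookNumber_remove {μ : YoungDiagram} {m : ℕ} (hm : μ.rowLen m = 0) {c : ℕ × ℕ}
    (hc : c ∈ corners μ) :
    hookNumber (remove μ c) * μ.card = hookNumber μ * rowWeight m μ c.1 := by
  rw [hookNumber_eq, hookNumber_eq, prod_hook_remove hm hc, ← card_remove hc, Nat.factorial_succ]
  have h1 : ∏ x ∈ (remove μ c).cells, hook (remove μ c) x.1 x.2 ≠ 0 :=
    (prod_pos fun x hx => hook_pos hx).ne'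
  have h2 : rowWeight m μ c.1 ≠ 0 := by
    intro h
    have h3 := prod_hook_remove hm hc
    rw [h, zero_mul] at h3
    exact (prod_pos fun x hx => hook_pos hx).ne' h3
  push_cast
  field_simp

theorem sum_corners_eq {μ : YoungDiagram} {m : ℕ} (hm : μ.rowLen m = 0) (F : ℕ → ℝ) :
    ∑ c ∈ corners μ, F c.1 = ∑ r ∈ range m with μ.rowLen (r + 1) < μ.rowLen r, F r := by
  refine sum_nbij' Prod.fst (fun r => (r, μ.rowLen r - 1)) ?_ ?_ ?_ ?_ ?_
  · intro c hc
    have := mem_corners_iff.1 hc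
    rw [mem_filter, mem_range]
    exact ⟨lt_of_mem_corners hm hc, by omega⟩
  · intro r hr
    rw [mem_filter, mem_range] at hr
    rw [mem_corners_iff]
    simp only
    omega
  · intro c hc
    have := mem_corners_iff.1 hc
    exact Prod.ext rfl (by simp only; omega)
  · intro r _
    rfl
  · intro c _
    rfl

theorem sum_corners_rowWeight {μ : YoungDiagram} {m : ℕ} (hm : μ.rowLen m = 0) :
    ∑ c ∈ corners μ, rowWeight m μ c.1 = μ.card := by
  rw [sum_corners_eq hm (rowWeight m μ), ← sum_rowLen hm]
  push_cast
  exact sum_weight (antitone_rowLen μ) hm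

theorem rowLen_colLen_zero (μ : YoungDiagram) : μ.rowLen (μ.colLen 0) = 0 := by
  by_contra h
  have := YoungDiagram.mem_iff_lt_colLen.1
    (YoungDiagram.mem_iff_lt_rowLen.2 (Nat.pos_of_ne_zero h))
  omega

theorem sum_hookNumber_remove {μ : YoungDiagram} (h : 0 < μ.card) :
    ∑ c ∈ corners μ, hookNumber (remove μ c) = hookNumber μ := by
  have hn : (μ.card : ℝ) ≠ 0 := by exact_mod_cast h.ne'
  have hm := rowLen_colLen_zero μ
  apply mul_right_cancel₀ hn
  rw [sum_mul, ← sum_corners_rowWeight hm, mul_sum]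
  refine sum_congr rfl fun c hc => ?_
  rw [sum_corners_rowWeight hm, hookNumber_remove hm hc]

theorem numWords_eq_hookNumber {n : ℕ} {μ : YoungDiagram} (h : μ.card = n) :
    (numWords n μ : ℝ) = hookNumber μ := by
  induction n generalizing μ with
  | zero =>
    have h0 : μ.cells = ∅ := card_eq_zero.1 h
    rw [numWords, words, if_pos h0, hookNumber, h, h0]
    simp
  | succ n ih =>
    rw [numWords_succ, ← sum_hookNumber_remove (by omega), Nat.cast_sum]
    refine sum_congr rfl fun c hc => ih ?_
    have := card_remove hc
    omega

/-! ### Counting words with a prescribed beginning -/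

/-- The shifted complete homogeneous function evaluated at the partition `μ`. -/
noncomputable def hom (k : ℕ) (μ : YoungDiagram) : ℝ :=
  shiftedHom k (μ.colLen 0) fun i => (μ.rowLen i : ℝ)

theorem hom_eq {μ : YoungDiagram} {m : ℕ} (hm : μ.rowLen m = 0) (k : ℕ) :
    hom k μ = shiftedHom k m fun i => (μ.rowLen i : ℝ) := by
  refine (shiftedHom_eq_of_le ?_ fun i hi => ?_).symm
  · by_contra h
    have := YoungDiagram.mem_iff_lt_rowLen.1 (YoungDiagram.mem_iff_lt_colLen.2 (not_le.1 h))
    omega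
  · rw [rowLen_eq_zero (rowLen_colLen_zero μ) hi, Nat.cast_zero]

theorem sum_rowWeight_mul_hom (μ : YoungDiagram) (k : ℕ) :
    ∑ c ∈ corners μ, rowWeight (μ.colLen 0) μ c.1 * hom k (remove μ c) =
      (μ.card - k) * hom k μ := by
  have hm := rowLen_colLen_zero μ
  have h := sum_weight_shiftedHom (antitone_rowLen μ) hm k
  rw [← sum_corners_eq hm (fun r => weight (range (μ.colLen 0)) (shiftedRow (μ.colLen 0)
    fun i => (μ.rowLen i : ℝ)) r * (shiftedHom k (μ.colLen 0) (fun i => (μ.rowLen i : ℝ)) -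
      shiftedHom k (μ.colLen 0) (fun i =>
        ((Function.update μ.rowLen r (μ.rowLen r - 1) i : ℕ) : ℝ))))] at h
  rw [sub_mul, ← sum_corners_rowWeight hm, sum_mul]
  change _ = _ - k * shiftedHom k (μ.colLen 0) (fun i => (μ.rowLen i : ℝ))
  rw [← h, ← sum_sub_distrib]
  refine sum_congr rfl fun c hc => ?_
  rw [hom_eq (rowLen_remove_eq_zero hm hc), rowLen_remove_eq_update hc, hom, ← rowWeight]
  ring

/-- The number of standard tableaux of shape `μ` that begin with a given row of length `k`. -/
noncomputable def rowCount (k : ℕ) (μ : YoungDiagram) : ℝ :=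
  hookNumber μ * hom k μ / falling μ.card k

/-- The closed formula obeys the same corner recursion as `runCount`, so the two need only be
compared on shapes with `k` cells. -/
theorem sum_rowCount_remove {k n : ℕ} (hk : k ≤ n) {μ : YoungDiagram} (h : μ.card = n + 1) :
    ∑ c ∈ corners μ, rowCount k (remove μ c) = rowCount k μ := by
  have hm := rowLen_colLen_zero μ
  have hk' : (k : ℝ) ≤ n := by exact_mod_cast hk
  have h1 : falling n k ≠ 0 := (falling_pos (by linarith)).ne'
  have h2 : falling (n + 1) k ≠ 0 := (falling_pos (by linarith)).ne'
  have h3 := falling_add_one n k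
  have hn : (n : ℝ) + 1 ≠ 0 := by positivity
  have e1 : ∀ c ∈ corners μ, rowCount k (remove μ c) = hookNumber μ / ((n + 1) * falling n k) *
      (rowWeight (μ.colLen 0) μ c.1 * hom k (remove μ c)) := by
    intro c hc
    have h4 := card_remove hc
    have h5 : (remove μ c).card = n := by omega
    have h6 := hookNumber_remove hm hc
    rw [h] at h6
    push_cast at h6
    rw [rowCount, h5]
    field_simp
    linear_combination hom k (remove μ c) * h6
  rw [sum_congr rfl e1, ← mul_sum, sum_rowWeight_mul_hom, rowCount, h]
  push_cast
  rw [← h3]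
  have h7 : (n : ℝ) + 1 - k ≠ 0 := by linarith
  field_simp

/-- Along a term the row lengths weakly increase while the shifts grow by one, so the integer
factors start at `≥ 0`, end at `≤ 0` and drop by at most one per step: one of them is zero. -/
theorem shiftedHom_eq_zero {k m : ℕ} {y : ℕ → ℕ} (hy : Antitone y) (h : y 0 < k) :
    shiftedHom k m (fun i => (y i : ℝ)) = 0 := by
  induction k generalizing m y with
  | zero => omega
  | succ k ih =>
    induction m with
    | zero => simp [shiftedHom]
    | succ m ihm =>
      rw [shiftedHom_succ_succ, ihm, zero_add]
      by_cases hm : y m = 0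
      · rw [hm, Nat.cast_zero, zero_mul]
      · have hc : ∀ i < m + 1, (y i : ℝ) - 1 = (((y i - 1 : ℕ) : ℝ)) := fun i hi => by
          have := hy (Nat.lt_succ_iff.1 hi)
          rw [Nat.cast_sub (by omega), Nat.cast_one]
        have h0 := hy (Nat.zero_le m)
        rw [shiftedHom_congr hc, ih (y := fun i => y i - 1)
          (fun a b hab => Nat.sub_le_sub_right (hy hab) 1) (show y 0 - 1 < k by omega), mul_zero]

theorem shiftedHom_single (k : ℕ) (x : ℕ → ℝ) : shiftedHom k 1 x = falling (x 0) k := by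
  induction k generalizing x with
  | zero => simp [shiftedHom, falling]
  | succ k ih => rw [shiftedHom, sum_range_one, ih, falling_succ']

theorem rowLen_add_le_card (μ : YoungDiagram) {i : ℕ} (hi : i ≠ 0) :
    μ.rowLen 0 + μ.rowLen i ≤ μ.card := by
  have hm : μ.rowLen (μ.colLen 0 + i + 1) = 0 :=
    rowLen_eq_zero (rowLen_colLen_zero μ) (by omega)
  rw [← sum_rowLen hm, ← sum_pair hi.symm]
  refine sum_le_sum_of_subset fun j hj => ?_
  simp only [mem_insert, mem_singleton] at hj
  rw [mem_range]
  omega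

theorem colLen_add_le_card (μ : YoungDiagram) {i : ℕ} (hi : i ≠ 0) :
    μ.colLen 0 + μ.colLen i ≤ μ.card := by
  have := rowLen_add_le_card μ.transpose hi
  rwa [YoungDiagram.rowLen_transpose, YoungDiagram.rowLen_transpose, card_transpose] at this

theorem words_of_row {k : ℕ} {μ : YoungDiagram} (h : μ.card = k) (h0 : μ.rowLen 0 = k) :
    words k μ = {List.replicate k 0} := by
  refine eq_singleton_iff_nonempty_unique_mem.2 ⟨?_, fun w hw => ?_⟩
  · rw [← card_pos]
    have := hookNumber_pos μ
    rw [← numWords_eq_hookNumber h] at this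
    exact_mod_cast this
  · rw [mem_words] at hw
    have h1 := hw.2.2 0
    rw [h0, ← hw.1, List.count_eq_length] at h1
    rw [List.eq_replicate_iff]
    exact ⟨hw.1, fun b hb => (h1 b hb).symm⟩

theorem rowCount_base {k : ℕ} {μ : YoungDiagram} (h : μ.card = k) :
    rowCount k μ = if μ.rowLen 0 = k then 1 else 0 := by
  have hle := rowLen_add_le_card μ one_ne_zero
  split_ifs with h0
  · have h1 : μ.rowLen 1 = 0 := by omega
    have h2 : hookNumber μ = 1 := by
      rw [← numWords_eq_hookNumber h, numWords, words_of_row h h0, card_singleton, Nat.cast_one]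
    rw [rowCount, h2, hom_eq h1, shiftedHom_single, h0, h, one_mul, div_self]
    exact (falling_pos (by linarith)).ne'
  · rw [rowCount, hom, shiftedHom_eq_zero (antitone_rowLen μ) (by omega), mul_zero, zero_div]

theorem ascent_replicate (k i : ℕ) : ascent i (List.replicate k 0) = false := by
  induction k generalizing i with
  | zero => cases i <;> rfl
  | succ k ih =>
    cases i with
    | succ i => exact ih i
    | zero =>
      cases k with
      | zero => rfl
      | succ k => simp [List.replicate_succ, ascent]

theorem runCount_false_base {k : ℕ} {μ : YoungDiagram} (h : μ.card = k) :
    (runCount false k 0 μ : ℝ) = rowCount k μ := by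
  rw [rowCount_base h, runCount]
  simp only [zero_add]
  split_ifs with h0
  · rw [words_of_row h h0, filter_singleton, if_pos fun i _ => ascent_replicate k i,
      card_singleton, Nat.cast_one]
  · rw [Nat.cast_eq_zero, card_eq_zero, filter_eq_empty_iff]
    intro w hw hasc
    rw [mem_words] at hw
    have := eq_replicate_of_no_ascent hw.2.1 fun i hi => hasc i (by omega)
    apply h0
    rw [← hw.2.2 0, this, List.count_replicate_self, hw.1]

theorem eq_range_reverse_of_nodup {w : List ℕ} (hw : IsLattice w) (hn : w.Nodup) :
    w = (List.range w.length).reverse := by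
  induction w with
  | nil => rfl
  | cons x w ih =>
    rw [List.nodup_cons] at hn
    have hw' := ih hw.1 hn.2
    rw [List.length_cons, List.range_succ, List.reverse_append, ← hw', List.reverse_singleton,
      List.singleton_append]
    congr 1
    apply le_antisymm
    · by_contra hx
      obtain ⟨r, rfl⟩ := Nat.exists_eq_succ_of_ne_zero (show x ≠ 0 by omega)
      have h1 := hw.2 r
      rw [List.count_cons_self, List.count_cons_of_ne (by omega),
        List.count_eq_zero_of_not_mem (l := w) (a := r)] at h1
      · omega
      · rw [hw', List.mem_reverse, List.mem_range]
        omega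
    · by_contra hx
      apply hn.1
      rw [hw', List.mem_reverse, List.mem_range]
      omega

theorem ascent_range_reverse {k i : ℕ} (hi : i + 1 < k) :
    ascent i (List.range k).reverse = true := by
  induction k generalizing i with
  | zero => omega
  | succ k ih =>
    rw [List.range_succ, List.reverse_append, List.reverse_singleton, List.singleton_append]
    cases i with
    | succ i => exact ih (by omega)
    | zero =>
      obtain ⟨k, rfl⟩ := Nat.exists_eq_succ_of_ne_zero (show k ≠ 0 by omega)
      rw [List.range_succ, List.reverse_append, List.reverse_singleton, List.singleton_append]
      simp [ascent]

theorem runCount_true_base {k : ℕ} {μ : YoungDiagram} (h : μ.card = k) :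
    (runCount true k 0 μ : ℝ) = rowCount k μ.transpose := by
  rw [rowCount_base ((card_transpose μ).trans h), runCount, YoungDiagram.rowLen_transpose]
  simp only [zero_add]
  have hle := colLen_add_le_card μ one_ne_zero
  split_ifs with h0
  · rw [filter_true_of_mem]
    · rw [← numWords, ← numWords_transpose, numWords, words_of_row ((card_transpose μ).trans h)
        (by rw [YoungDiagram.rowLen_transpose, h0]), card_singleton, Nat.cast_one]
    · intro w hw i hi
      rw [mem_words] at hw
      have hn : w.Nodup := by
        rw [List.nodup_iff_count_le_one]
        intro r
        rw [hw.2.2]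
        by_contra hr
        have := YoungDiagram.mem_iff_lt_colLen.1
          (YoungDiagram.mem_iff_lt_rowLen.2 (not_le.1 hr))
        omega
      rw [eq_range_reverse_of_nodup hw.2.1 hn, hw.1]
      exact ascent_range_reverse (by omega)
  · rw [Nat.cast_eq_zero, card_eq_zero, filter_eq_empty_iff]
    intro w hw hasc
    rw [mem_words] at hw
    have hw' := eq_range_reverse_of_ascent hw.2.1 fun i hi => hasc i (by omega)
    have h1 := hw.2.2 (k - 1)
    have h2 : 0 < w.count (k - 1) := by
      rw [List.count_pos_iff, hw', List.mem_reverse, List.mem_range]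
      omega
    rw [h1] at h2
    have := YoungDiagram.mem_iff_lt_colLen.1 (YoungDiagram.mem_iff_lt_rowLen.2 h2)
    omega

theorem runCount_false (k N : ℕ) {μ : YoungDiagram} (h : μ.card = N + k) :
    (runCount false k N μ : ℝ) = rowCount k μ := by
  induction N generalizing μ with
  | zero => exact runCount_false_base (h.trans (zero_add k))
  | succ N ih =>
    rw [runCount_succ, ← sum_rowCount_remove (n := N + k) (by omega) (by omega), Nat.cast_sum]
    refine sum_congr rfl fun c hc => ih ?_
    have := card_remove hc
    omega

theorem runCount_true (k N : ℕ) {μ : YoungDiagram} (h : μ.card = N + k) :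
    (runCount true k N μ : ℝ) = rowCount k μ.transpose := by
  induction N generalizing μ with
  | zero => exact runCount_true_base (h.trans (zero_add k))
  | succ N ih =>
    rw [runCount_succ, ← sum_rowCount_remove (n := N + k) (by omega)
      ((card_transpose μ).trans (by omega)), Nat.cast_sum, sum_corners_transpose]
    refine sum_congr rfl fun c hc => ih ?_
    have := card_remove hc
    omega

/-! ### The coefficients -/

theorem coeffCSum_eq (μ : YoungDiagram) : coeffCSum μ = hom 2 μ / falling μ.card 2 := by
  simp only [coeffCSum, hom, shiftedHom, falling, prod_range_succ, prod_range_zero, mul_sum,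
    sum_div]
  refine sum_congr rfl fun i _ => sum_congr rfl fun j _ => ?_
  push_cast
  ring

theorem coeffD_eq (μ : YoungDiagram) : coeffD μ = hom 3 μ / falling μ.card 3 := by
  simp only [coeffD, hom, shiftedHom, falling, prod_range_succ, prod_range_zero, mul_sum,
    sum_div, sum_filter]
  refine sum_congr rfl fun i _ => sum_congr rfl fun j hj => sum_congr rfl fun k hk => ?_
  rw [mem_range] at hj hk
  have h1 := μ.rowLen_anti k j (by omega)
  have h2 := μ.rowLen_anti j i (by omega)
  split_ifs with h
  · push_cast
    ring
  -- The terms excluded by the condition vanish anyway, because `μ_i ≤ μ_j ≤ μ_k ≤ 2`.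
  · have : μ.rowLen k = 2 ∨ μ.rowLen j = 1 ∨ μ.rowLen i = 0 := by omega
    rcases this with h | h | h <;> rw [h] <;> norm_num

theorem coeffE_eq (μ : YoungDiagram) : coeffE μ = hom 4 μ / falling μ.card 4 := by
  simp only [coeffE, hom, shiftedHom, falling, prod_range_succ, prod_range_zero, mul_sum,
    sum_div, sum_filter]
  refine sum_congr rfl fun i _ => sum_congr rfl fun j hj => sum_congr rfl fun k hk =>
    sum_congr rfl fun l hl => ?_
  rw [mem_range] at hj hk hl
  have h1 := μ.rowLen_anti l k (by omega)
  have h2 := μ.rowLen_anti k j (by omega)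
  have h3 := μ.rowLen_anti j i (by omega)
  split_ifs with h
  · push_cast
    ring
  · have : μ.rowLen l = 3 ∨ μ.rowLen k = 2 ∨ μ.rowLen j = 1 ∨ μ.rowLen i = 0 := by omega
    rcases this with h | h | h | h <;> rw [h] <;> norm_num

theorem two_mul_sum_lower (m : ℕ) (x : ℕ → ℝ) :
    2 * ∑ i ∈ range m, ∑ j ∈ range (i + 1), x i * (x j - 1) =
      (∑ i ∈ range m, x i) ^ 2 + ∑ i ∈ range m, x i * (x i - 1) - ∑ i ∈ range m, x i -
        2 * ∑ i ∈ range m, i * x i := by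
  induction m with
  | zero => simp
  | succ m ih =>
    simp only [sum_range_succ _ m, mul_add, ih]
    simp only [← mul_sum, sum_sub_distrib, sum_const, card_range, nsmul_eq_mul, mul_one]
    ring

/-- Both sides are twice the sum of the row indices of all cells, computed by columns and by rows.
-/
theorem sum_colLen_mul (μ : YoungDiagram) :
    ∑ j ∈ range (μ.rowLen 0), (μ.colLen j : ℝ) * ((μ.colLen j : ℝ) - 1) =
      2 * ∑ i ∈ range (μ.colLen 0), (i : ℝ) * μ.rowLen i := by
  have hg : ∀ n : ℕ, ∑ i ∈ range n, (i : ℝ) = n * (n - 1) / 2 := fun n => by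
    induction n with
    | zero => simp
    | succ n ih => rw [sum_range_succ, ih]; push_cast; ring
  have h1 : ∑ x ∈ μ.cells, (x.1 : ℝ) = ∑ i ∈ range (μ.colLen 0), (i : ℝ) * μ.rowLen i := by
    rw [sum_finset_product _ (range (μ.colLen 0)) (fun i => range (μ.rowLen i))]
    · refine sum_congr rfl fun i _ => ?_
      simp [mul_comm]
    · rintro ⟨i, j⟩
      rw [mem_range, ← YoungDiagram.mem_iff_lt_colLen, mem_range, ← YoungDiagram.mem_iff_lt_rowLen]
      exact ⟨fun h => ⟨μ.up_left_mem le_rfl (Nat.zero_le j) h, h⟩, fun h => h.2⟩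
  have h2 : ∑ x ∈ μ.cells, (x.1 : ℝ) =
      ∑ j ∈ range (μ.rowLen 0), (μ.colLen j : ℝ) * ((μ.colLen j : ℝ) - 1) / 2 := by
    rw [sum_finset_product_right _ (range (μ.rowLen 0)) (fun j => range (μ.colLen j))]
    · exact sum_congr rfl fun j _ => hg _
    · rintro ⟨i, j⟩
      rw [mem_range, ← YoungDiagram.mem_iff_lt_rowLen, mem_range, ← YoungDiagram.mem_iff_lt_colLen]
      exact ⟨fun h => ⟨μ.up_left_mem (Nat.zero_le i) le_rfl h, h⟩, fun h => h.2⟩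
  rw [← h1, h2, ← sum_div]
  ring

/-- Completing the triangular sum to a square leaves `∑ i μ_i`, which `sum_colLen_mul` turns into
the conjugate parts. -/
theorem coeffC_eq_coeffCSum {μ : YoungDiagram} (h : 2 ≤ μ.card) : coeffC μ = coeffCSum μ := by
  have h2 : (2 : ℝ) ≤ μ.card := by exact_mod_cast h
  have h0 : (μ.card : ℝ) ≠ 0 := by linarith
  have h1 : (μ.card : ℝ) - 1 ≠ 0 := by linarith
  have hs := two_mul_sum_lower (μ.colLen 0) fun i => (μ.rowLen i : ℝ)
  have hn : ∑ i ∈ range (μ.colLen 0), (μ.rowLen i : ℝ) = μ.card := by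
    rw [← sum_rowLen (rowLen_colLen_zero μ)]
    push_cast
    rfl
  rw [hn, ← sum_colLen_mul] at hs
  simp only [coeffC, coeffCSum, ← sum_div]
  field_simp
  linear_combination -hs

/-! ### Moments of the descent function -/

theorem expectation_eq {μ : YoungDiagram} {n : ℕ} (hn : μ.card = n) (f : ℕ → ℝ) :
    expectation μ (descentFun f) =
      (∑ i ∈ Icc 1 (n - 1), f i * ascentPairs n μ (n - 1 - i) (n - 1 - i)) / numWords n μ := by
  subst hn
  rw [expectation, card_standardTableau]
  congr 1
  simp only [descentFun_eq]
  rw [sum_tableauWord (fun w => ∑ i ∈ Icc 1 (μ.card - 1),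
      if ascent (μ.card - 1 - i) w = true then f i else 0), sum_comm]
  refine sum_congr rfl fun i _ => ?_
  rw [ascentPairs, card_filter, Nat.cast_sum, mul_sum]
  refine sum_congr rfl fun w _ => ?_
  simp only [and_self]
  split_ifs <;> simp

theorem expectation_sq_eq {μ : YoungDiagram} {n : ℕ} (hn : μ.card = n) (f : ℕ → ℝ) :
    expectation μ (fun T => descentFun f T ^ 2) =
      (∑ i ∈ Icc 1 (n - 1), ∑ j ∈ Icc 1 (n - 1),
        f i * f j * ascentPairs n μ (n - 1 - i) (n - 1 - j)) / numWords n μ := by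
  subst hn
  rw [expectation, card_standardTableau]
  congr 1
  simp only [descentFun_eq]
  rw [sum_tableauWord (fun w => (∑ i ∈ Icc 1 (μ.card - 1),
      if ascent (μ.card - 1 - i) w = true then f i else 0) ^ 2)]
  simp only [sq, sum_mul_sum]
  rw [sum_comm]
  refine sum_congr rfl fun i _ => ?_
  rw [sum_comm]
  refine sum_congr rfl fun j _ => ?_
  rw [ascentPairs, card_filter, Nat.cast_sum, mul_sum]
  refine sum_congr rfl fun w _ => ?_
  cases ascent (μ.card - 1 - i) w <;> cases ascent (μ.card - 1 - j) w <;> simp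

theorem numWords_pos {μ : YoungDiagram} {n : ℕ} (hn : μ.card = n) : (0 : ℝ) < numWords n μ := by
  rw [numWords_eq_hookNumber hn]
  exact hookNumber_pos μ

theorem variance_eq (μ : YoungDiagram) (X : StandardTableau μ → ℝ) :
    variance μ X = expectation μ (fun T => X T ^ 2) - expectation μ X ^ 2 := by
  have hN : (Fintype.card (StandardTableau μ) : ℝ) ≠ 0 := by
    rw [card_standardTableau]
    exact (numWords_pos rfl).ne'
  have hX : ∑ T, X T = expectation μ X * Fintype.card (StandardTableau μ) := by
    rw [expectation, div_mul_cancel₀ _ hN]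
  rw [variance]
  set e := expectation μ X with he
  rw [expectation, expectation, eq_sub_iff_add_eq, div_add' _ _ _ hN]
  congr 1
  have : ∀ T, (X T - e) ^ 2 = X T ^ 2 - 2 * e * X T + e ^ 2 := fun T => by ring
  simp only [this, sum_add_distrib, sum_sub_distrib, ← mul_sum, hX, sum_const, card_univ,
    nsmul_eq_mul]
  ring

theorem sum_sum_symm (m : ℕ) (g : ℕ → ℕ → ℝ) (hg : ∀ i j, g i j = g j i) :
    ∑ i ∈ Icc 1 m, ∑ j ∈ Icc 1 m, g i j =
      ∑ i ∈ Icc 1 m, g i i + 2 * ∑ i ∈ Icc 1 (m - 1), g i (i + 1) +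
        2 * ∑ i ∈ Icc 1 m, ∑ j ∈ Icc 1 m with j + 1 < i, g i j := by
  have h1 : ∑ i ∈ Icc 1 m, ∑ j ∈ Icc 1 m, (if i = j then g i j else 0) = ∑ i ∈ Icc 1 m, g i i := by
    refine sum_congr rfl fun i hi => ?_
    rw [sum_ite_eq, if_pos hi]
  have h2 : ∑ i ∈ Icc 1 m, ∑ j ∈ Icc 1 m, (if i + 1 = j then g i j else 0) =
      ∑ i ∈ Icc 1 (m - 1), g i (i + 1) := by
    simp only [sum_ite_eq]
    rw [← sum_filter]
    refine sum_congr ?_ fun _ _ => rfl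
    ext i
    simp only [mem_filter, mem_Icc]
    omega
  have h3 : ∑ i ∈ Icc 1 m, ∑ j ∈ Icc 1 m, (if j + 1 = i then g i j else 0) =
      ∑ i ∈ Icc 1 (m - 1), g i (i + 1) := by
    rw [← h2, sum_comm]
    simp only [hg]
  have h4 : ∑ i ∈ Icc 1 m, ∑ j ∈ Icc 1 m, (if i + 1 < j then g i j else 0) =
      ∑ i ∈ Icc 1 m, ∑ j ∈ Icc 1 m, (if j + 1 < i then g i j else 0) := by
    rw [sum_comm]
    refine sum_congr rfl fun i _ => sum_congr rfl fun j _ => ?_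
    rw [hg]
  simp only [sum_filter]
  rw [two_mul, two_mul]
  nth_rw 1 [← h2]
  nth_rw 1 [← h4]
  rw [← h1, ← h3]
  simp only [← sum_add_distrib]
  refine sum_congr rfl fun i _ => sum_congr rfl fun j _ => ?_
  rcases lt_trichotomy i j with h | h | h
  · rcases (show i + 1 ≤ j from h).eq_or_lt with h' | h'
    · subst h'; simp [show ¬ i + 1 + 1 = i by omega, show ¬ i + 1 + 1 < i by omega]
    · simp [show i ≠ j by omega, show i + 1 ≠ j by omega, show j + 1 ≠ i by omega, h',
        show ¬ j + 1 < i by omega]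
  · subst h; simp
  · rcases (show j + 1 ≤ i from h).eq_or_lt with h' | h'
    · subst h'; simp [show ¬ j + 1 + 1 = j by omega, show ¬ j + 1 + 1 < j by omega]
    · simp [show i ≠ j by omega, show i + 1 ≠ j by omega, show j + 1 ≠ i by omega, h',
        show ¬ i + 1 < j by omega]

theorem rowCount_eq {k : ℕ} {μ : YoungDiagram} {n : ℕ} (hn : μ.card = n) :
    rowCount k μ = hom k μ / falling μ.card k * numWords n μ := by
  rw [numWords_eq_hookNumber hn, rowCount]
  ring

theorem rowCount_transpose_eq {k : ℕ} {μ : YoungDiagram} {n : ℕ} (hn : μ.card = n) :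
    rowCount k μ.transpose =
      hom k μ.transpose / falling μ.transpose.card k * numWords n μ := by
  rw [rowCount_eq ((card_transpose μ).trans hn), numWords_transpose]

theorem ascentPairs_self_eq {μ : YoungDiagram} {n : ℕ} (hn : μ.card = n) {i : ℕ}
    (hi : i ∈ Icc 1 (n - 1)) :
    (ascentPairs n μ (n - 1 - i) (n - 1 - i) : ℝ) = coeffC μ.transpose * numWords n μ := by
  rw [mem_Icc] at hi
  obtain ⟨N, rfl⟩ := Nat.exists_eq_add_of_le' (show 2 ≤ n by omega)
  rw [ascentPairs_diag μ (by omega), ← runCount_two, runCount_true 2 N hn,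
    rowCount_transpose_eq hn, ← coeffCSum_eq, coeffC_eq_coeffCSum]
  rw [card_transpose]
  omega

theorem ascentPairs_succ_eq {μ : YoungDiagram} {n : ℕ} (hn : μ.card = n) {i : ℕ}
    (hi : i ∈ Icc 1 (n - 2)) :
    (ascentPairs n μ (n - 1 - i) (n - 1 - (i + 1)) : ℝ) =
      coeffD μ.transpose * numWords n μ := by
  rw [mem_Icc] at hi
  obtain ⟨N, rfl⟩ := Nat.exists_eq_add_of_le' (show 3 ≤ n by omega)
  rw [ascentPairs_comm, show N + 3 - 1 - i = N + 3 - 1 - (i + 1) + 1 by omega,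
    ascentPairs_adjacent μ (by omega), ← runCount_three, runCount_true 3 N hn,
    rowCount_transpose_eq hn, ← coeffD_eq]

theorem ascentPairs_far_eq_coeff {μ : YoungDiagram} {n : ℕ} (hn : μ.card = n) {i j : ℕ}
    (hi : i ≤ n - 1) (hj : 1 ≤ j) (hij : j + 1 < i) :
    (ascentPairs n μ (n - 1 - i) (n - 1 - j) : ℝ) =
      (coeffC μ.transpose - coeffD μ - coeffD μ.transpose + coeffE μ + coeffE μ.transpose) *
        numWords n μ := by
  obtain ⟨N, rfl⟩ := Nat.exists_eq_add_of_le' (show 4 ≤ n by omega)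
  have h : (ascentPairs (N + 4) μ N (N + 2) : ℝ) + runCount false 3 (N + 1) μ +
      runCount true 3 (N + 1) μ =
      runCount true 2 (N + 2) μ + runCount false 4 N μ + runCount true 4 N μ := by
    exact_mod_cast ascentPairs_far_eq N μ
  rw [runCount_false 3 (N + 1) (by omega), runCount_true 3 (N + 1) (by omega),
    runCount_true 2 (N + 2) (by omega), runCount_false 4 N hn, runCount_true 4 N hn,
    rowCount_eq hn, rowCount_eq hn, rowCount_transpose_eq hn, rowCount_transpose_eq hn,
    rowCount_transpose_eq hn, ← coeffCSum_eq, ← coeffD_eq, ← coeffD_eq, ← coeffE_eq, ← coeffE_eq,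
    ← coeffC_eq_coeffCSum (by rw [card_transpose]; omega)] at h
  rw [ascentPairs_far μ (by omega) (by omega)]
  linear_combination h

end DescentStat

theorem theorem2p1 (f : ℕ → ℝ) (n : ℕ) (lam : YoungDiagram) (hn : lam.card = n) :
    DescentStat.expectation lam (DescentStat.descentFun f) =
        DescentStat.coeffC lam.transpose * ∑ i ∈ Finset.Icc 1 (n - 1), f i
    ∧ DescentStat.variance lam (DescentStat.descentFun f) =
        DescentStat.coeffC lam.transpose * ∑ i ∈ Finset.Icc 1 (n - 1), f i ^ 2
        + 2 * DescentStat.coeffD lam.transpose * ∑ i ∈ Finset.Icc 1 (n - 2), f i * f (i + 1)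
        + 2 * (DescentStat.coeffC lam.transpose - DescentStat.coeffD lam
              - DescentStat.coeffD lam.transpose
              + DescentStat.coeffE lam + DescentStat.coeffE lam.transpose)
            * ∑ i ∈ Finset.Icc 1 (n - 1), ∑ j ∈ Finset.Icc 1 (n - 1) with j + 1 < i, f i * f j
        - (DescentStat.coeffC lam.transpose * ∑ i ∈ Finset.Icc 1 (n - 1), f i) ^ 2
    ∧ (2 ≤ n → DescentStat.coeffC lam.transpose = DescentStat.coeffCSum lam.transpose)
    ∧ (Fintype.card (DescentStat.StandardTableau lam) : ℝ) = DescentStat.hookNumber lam := by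
  have hN := (DescentStat.numWords_pos hn).ne'
  have hE : DescentStat.expectation lam (DescentStat.descentFun f) =
      DescentStat.coeffC lam.transpose * ∑ i ∈ Finset.Icc 1 (n - 1), f i := by
    rw [DescentStat.expectation_eq hn, div_eq_iff hN, mul_sum, sum_mul]
    refine sum_congr rfl fun i hi => ?_
    rw [DescentStat.ascentPairs_self_eq hn hi]
    ring
  refine ⟨hE, ?_, fun h => ?_, ?_⟩
  · rw [DescentStat.variance_eq, hE, DescentStat.expectation_sq_eq hn]
    congr 1
    rw [div_eq_iff hN, DescentStat.sum_sum_symm (n - 1) _ fun i j => by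
      rw [DescentStat.ascentPairs_comm, mul_comm (f i)], Nat.sub_sub]
    simp only [add_mul, mul_assoc, mul_sum, sum_mul]
    refine congrArg₂ _ (congrArg₂ _ ?_ ?_) ?_
    · refine sum_congr rfl fun i hi => ?_
      rw [DescentStat.ascentPairs_self_eq hn hi]
      ring
    · refine sum_congr rfl fun i hi => ?_
      rw [DescentStat.ascentPairs_succ_eq hn hi]
      ring
    · refine sum_congr rfl fun i hi => sum_congr rfl fun j hj => ?_
      rw [mem_filter, mem_Icc] at hj
      rw [DescentStat.ascentPairs_far_eq_coeff hn (mem_Icc.1 hi).2 hj.1.1 hj.2]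
      ring
  · rw [DescentStat.coeffC_eq_coeffCSum]
    rwa [DescentStat.card_transpose, hn]
  · rw [DescentStat.card_standardTableau, DescentStat.numWords_eq_hookNumber rfl]
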